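/- Let $X$ be a countably infinite set, let $P,\widehat P:X\times X\to[0,1]$ be sub-probability kernels ($\sum_{y}P(x,y)\le 1$ and $\sum_y\widehat P(x,y)\le 1$ for all $x$), and let $\mu:X\to(0,\infty)$ satisfy $\mu(x)P(x,y)=\mu(y)\widehat P(y,x)$ for all $x,y\in X$. Put $p(x,y)=P(x,y)/\mu(y)$. Assume: (A1) $P(x,y)>0$ for all $x,y\in X$, and there is a constant $C_*\ge 1$ with $\sum_{z\in X}P(x,z)P(z,y)\le C_*P(x,y)$ for all $x,y\in X$; (A2) $C_-:=\inf_{x\in X}P(x,x)>0$; (A3) $\sup_{x,y\in X}P(x,y)/\mu(y)<\infty$. Let $V:X\to(0,\infty)$ be a potential with $\inf_X V>0$ which is confining: for every $M\in\mathbb N$ there is a finite set $B_M\subset X$ such that $V\ge M$ on $X\setminus B_M$. Let $$\mathcal Uf(x)=\frac1{V(x)}\sum_{y\in X}P(x,y)f(y),\qquad \widehat{\mathcal U}f(x)=\sum_{y\in X}\widehat P(x,y)\frac1{V(y)}f(y),$$ and let $\lambda_0=\sup\{|\lambda|:\lambda\in\sigma(\mathcal U)\}$ be the spectral radius of $\mathcal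 U$ on the complex space $\ell^2(X,\mu)$. Let $u_n$ be the kernel of $\mathcal U^n$ with respect to $\mu$, that is, $u_1(x,y)=u(x,y)=p(x,y)/V(x)$ and $u_{n+1}(x,y)=\sum_{z\in X}u(x,z)u_n(z,y)\mu(z)$ for $n\ge1$. Then there are unique functions $\phi_0,\widehat\phi_0:X\to(0,\infty)$ with $\|\phi_0\|_{\ell^2(\mu)}=\|\widehat\phi_0\|_{\ell^2(\mu)}=1$, $\mathcal U\phi_0=\lambda_0\phi_0$ and $\widehat{\mathcal U}\widehat\phi_0=\lambda_0\widehat\phi_0$ (the ground states), and the following holds. Let $(A_n)_{n\in\mathbb N}$ be a sequence of subsets of $X$ with $A_n\subseteq A_{n+1}$ and $\bigcup_nA_n=X$, put $\alpha(x)=\min\{n:x\in A_n\}$, and assume that $V$ is increasing with respect to $(A_n)$, i.e. $V(x)\le V(y)$ whenever $\alpha(x)<\alpha(y)$. Let $B\subset X$ be finite. Then there is a constant $\widetilde C>0$, independent of $n$, $x$ and $y$, such that the following estimates hold for all $n\ge1$. (i) If $x\in B$ or $y\in B$, then $$\widetilde C^{-1}\lambda_0^n\phi_0(x)\widehat\phi_0(y)\le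 u_n(x,y)\le\widetilde C\,\lambda_0^n\phi_0(x)\widehat\phi_0(y).$$ (ii) If $x,y\in B^c$, then $$\widetilde C^{-1}\big(\lambda_0^n\phi_0(x)\widehat\phi_0(y)+C_{\rm low}^nF_n(x,y)\big)\le u_n(x,y)\le\widetilde C\big(\lambda_0^n\phi_0(x)\widehat\phi_0(y)+C_{\rm up}^nF_n(x,y)\big),$$ where $C_{\rm low}=\min\{C_*^{-1},C_-\}$, $C_{\rm up}=\max\{3C_*,C_-^{-1}\}$ and $$F_n(x,y)=\frac1{V(x)}\sum_{z\in B^c\cap A_{\alpha(x)}\cap A_{\alpha(y)}}p(x,z)\,p(z,y)\,\frac1{V(z)^{n-1}}\,\mu(z).$$ In particular, $u_n(x,y)\ge\widetilde C^{-1}\lambda_0^n\phi_0(x)\widehat\phi_0(y)$ for all $x,y\in X$ and all $n\ge1$. -/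

import Mathlib

open MeasureTheory
open scoped ENNReal

noncomputable section

namespace FeynmanKac

/-- A sub-probability kernel `P` on `X`, together with a second sub-probability kernel `Pd` and a
strictly positive measure `μ` on `X` such that `μ(x) P(x,y) = μ(y) Pd(y,x)`. -/
structure DualKernels (X : Type*) where
  P : X → X → ℝ
  Pd : X → X → ℝ
  μ : X → ℝ
  P_nonneg : ∀ x y, 0 ≤ P x y
  P_summable : ∀ x, Summable (P x)
  P_tsum_le_one : ∀ x, ∑' y, P x y ≤ 1
  Pd_nonneg : ∀ x y, 0 ≤ Pd x y
  Pd_summable : ∀ x, Summable (Pd x)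
  Pd_tsum_le_one : ∀ x, ∑' y, Pd x y ≤ 1
  μ_pos : ∀ x, 0 < μ x
  duality : ∀ x y, μ x * P x y = μ y * Pd y x

/-- A potential `V : X → (0,∞)` with `inf V > 0`. -/
structure Potential (X : Type*) where
  V : X → ℝ
  lowerBounded : ∃ c : ℝ, 0 < c ∧ ∀ x, c ≤ V x

/-- `V` is confining: for every `M ∈ ℕ`, `V ≥ M` outside some finite set. -/
def Potential.Confining {X : Type*} (W : Potential X) : Prop :=
  ∀ M : ℕ, ∃ S : Set X, S.Finite ∧ ∀ x ∉ S, (M : ℝ) ≤ W.V x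

/-- An exhausting sequence of subsets of `X`. -/
def IsExhausting {X : Type*} (A : ℕ → Set X) : Prop :=
  (∀ n, A n ⊆ A (n + 1)) ∧ ⋃ n, A n = Set.univ

/-- The first appearance function `α(x) = min {n : x ∈ A n}`. -/
def firstAppearance {X : Type*} (A : ℕ → Set X) (x : X) : ℕ :=
  sInf {n | x ∈ A n}

/-- `V` is increasing with respect to the sequence `A`. -/
def Potential.IncreasingAlong {X : Type*} (W : Potential X) (A : ℕ → Set X) : Prop :=
  ∀ x y, firstAppearance A x < firstAppearance A y → W.V x ≤ W.V y

namespace DualKernels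

variable {X : Type*} (K : DualKernels X)

/-- The two-step transition probabilities. -/
def P₂ (x y : X) : ℝ := ∑' z, K.P x z * K.P z y

/-- The transition density `p(x,y) = P(x,y) / μ(y)`. -/
def p (x y : X) : ℝ := K.P x y / K.μ y

/-- The direct step property with constant `Cs`, including positivity of `P`. -/
def DirectStep (Cs : ℝ) : Prop :=
  (∀ x y, 0 < K.P x y) ∧ 1 ≤ Cs ∧ ∀ x y, K.P₂ x y ≤ Cs * K.P x y

/-- The laziness constant `C₋ = inf_x P(x,x)`. -/
def Cminus : ℝ := ⨅ x, K.P x x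

/-- `sup_{x,y} P(x,y)/μ(y) < ∞`. -/
def BoundedDensity : Prop := ∃ M : ℝ, ∀ x y, K.P x y / K.μ y ≤ M

/-- The one-step Feynman–Kac kernel `u(x,y) = p(x,y) / V(x)` with respect to `μ`. -/
def u (W : Potential X) (x y : X) : ℝ := (W.V x)⁻¹ * K.p x y

open Classical in
/-- The `n`-step Feynman–Kac kernel: `u_0(x,y) = 1_{x=y}`, `u_1 = u`, and
`u_{n+1}(x,y) = ∑_z u(x,z) u_n(z,y) μ(z)` for `n ≥ 1`. -/
def uStep (W : Potential X) : ℕ → X → X → ℝ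
  | 0 => fun x y => if x = y then 1 else 0
  | 1 => fun x y => K.u W x y
  | n + 2 => fun x y => ∑' z, K.u W x z * uStep W (n + 1) z y * K.μ z

/-- `F_n(x,y) = V(x)⁻¹ ∑_z p(x,z) p(z,y) V(z)^{-(n-1)} μ(z)`, the sum being over
`z ∈ Bᶜ ∩ A_{α(x)} ∩ A_{α(y)}`. It is used for `n ≥ 1` only. -/
def F (W : Potential X) (A : ℕ → Set X) (B : Set X) (n : ℕ) (x y : X) : ℝ :=
  (W.V x)⁻¹ *
    ∑' z : ↥(Bᶜ ∩ A (firstAppearance A x) ∩ A (firstAppearance A y)),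
      K.p x z * K.p z y * (1 / W.V z ^ (n - 1)) * K.μ z

theorem tsum_ofReal_P_le (x : X) : ∑' y, ENNReal.ofReal (K.P x y) ≤ 1 := by
  rw [← ENNReal.ofReal_tsum_of_nonneg (K.P_nonneg x) (K.P_summable x)]
  simpa using K.P_tsum_le_one x

theorem tsum_ofReal_mu_P_le (y : X) :
    ∑' x, ENNReal.ofReal (K.μ x) * ENNReal.ofReal (K.P x y) ≤ ENNReal.ofReal (K.μ y) := by
  have h : ∀ x, ENNReal.ofReal (K.μ x) * ENNReal.ofReal (K.P x y)
      = ENNReal.ofReal (K.μ y) * ENNReal.ofReal (K.Pd y x) := fun x => by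
    rw [← ENNReal.ofReal_mul (K.μ_pos x).le, K.duality, ENNReal.ofReal_mul (K.μ_pos y).le]
  simp_rw [h]
  rw [ENNReal.tsum_mul_left, ← ENNReal.ofReal_tsum_of_nonneg (K.Pd_nonneg y) (K.Pd_summable y)]
  calc _ ≤ ENNReal.ofReal (K.μ y) * 1 := by
        gcongr
        simpa using K.Pd_tsum_le_one y
    _ = _ := mul_one _

theorem sq_tsum_le (w g : X → ℝ≥0∞) (hw : ∑' y, w y ≤ 1) :
    (∑' y, w y * g y) ^ 2 ≤ 2 * ∑' y, w y * g y ^ 2 := by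
  have hmul : ∀ a b : ℝ≥0∞, a * b ≤ a ^ 2 + b ^ 2 := fun a b => by
    rcases le_total a b with h | h
    · calc a * b ≤ b * b := by gcongr
        _ ≤ _ := by rw [← sq]; exact le_add_self
    · calc a * b ≤ a * a := by gcongr
        _ ≤ _ := by rw [← sq]; exact le_self_add
  calc (∑' y, w y * g y) ^ 2 = ∑' y, ∑' z, (w y * g y) * (w z * g z) := by
        simp_rw [ENNReal.tsum_mul_left, ENNReal.tsum_mul_right, sq]
    _ ≤ ∑' y, ∑' z, ((w y * g y ^ 2) * w z + w y * (w z * g z ^ 2)) := by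
        refine ENNReal.tsum_le_tsum fun y => ENNReal.tsum_le_tsum fun z => ?_
        calc (w y * g y) * (w z * g z) = w y * w z * (g y * g z) := by ring
          _ ≤ w y * w z * (g y ^ 2 + g z ^ 2) := by gcongr; exact hmul _ _
          _ = _ := by ring
    _ = (∑' y, w y * g y ^ 2) * (∑' z, w z) + (∑' y, w y) * ∑' z, w z * g z ^ 2 := by
        simp_rw [ENNReal.tsum_add, ENNReal.tsum_mul_left, ENNReal.tsum_mul_right]
    _ ≤ (∑' y, w y * g y ^ 2) * 1 + 1 * ∑' z, w z * g z ^ 2 := by gcongr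
    _ = _ := by ring

/-- The Schur-type bound behind the boundedness of `𝒰` on `ℓ²(μ)`. -/
theorem tsum_P_sq_le (f : X → ℂ) :
    ∑' x, ENNReal.ofReal (K.μ x) * (∑' y, ‖(K.P x y : ℂ) * f y‖ₑ) ^ 2
      ≤ 2 * ∑' y, ENNReal.ofReal (K.μ y) * ‖f y‖ₑ ^ 2 := by
  have hn : ∀ x y, ‖(K.P x y : ℂ) * f y‖ₑ = ENNReal.ofReal (K.P x y) * ‖f y‖ₑ := fun x y => by
    rw [enorm_mul, ← ofReal_norm (K.P x y : ℂ), Complex.norm_real,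
      Real.norm_of_nonneg (K.P_nonneg x y)]
  simp_rw [hn]
  calc _ ≤ ∑' x, ENNReal.ofReal (K.μ x) *
          (2 * ∑' y, ENNReal.ofReal (K.P x y) * ‖f y‖ₑ ^ 2) := by
        refine ENNReal.tsum_le_tsum fun x => ?_
        gcongr
        exact sq_tsum_le _ _ (K.tsum_ofReal_P_le x)
    _ = 2 * ∑' x, ∑' y,
          ENNReal.ofReal (K.μ x) * (ENNReal.ofReal (K.P x y) * ‖f y‖ₑ ^ 2) := by
        rw [← ENNReal.tsum_mul_left]
        refine tsum_congr fun x => ?_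
        rw [ENNReal.tsum_mul_left]
        ring
    _ = 2 * ∑' y, (∑' x, ENNReal.ofReal (K.μ x) * ENNReal.ofReal (K.P x y)) * ‖f y‖ₑ ^ 2 := by
        rw [ENNReal.tsum_comm]
        congr 1
        refine tsum_congr fun y => ?_
        rw [← ENNReal.tsum_mul_right]
        exact tsum_congr fun x => by ring
    _ ≤ _ := by
        gcongr with y
        exact K.tsum_ofReal_mu_P_le y

section Operator

variable [MeasurableSpace X]

/-- The measure on `X` with point masses `μ(x)`. -/
def siteMeasure : Measure X :=
  Measure.sum fun x => ENNReal.ofReal (K.μ x) • Measure.dirac x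

/-- The complex Hilbert space `ℓ²(X, μ)`. -/
abbrev ellTwo : Type _ := Lp ℂ 2 K.siteMeasure

/-- The Feynman–Kac operator on functions, `𝒰 f(x) = V(x)⁻¹ ∑_y P(x,y) f(y)`. -/
def fkFun (W : Potential X) (f : X → ℂ) (x : X) : ℂ :=
  ((W.V x)⁻¹ : ℂ) * ∑' y, (K.P x y : ℂ) * f y

variable [DiscreteMeasurableSpace X] [Countable X]

theorem forall_of_ae {q : X → Prop} (h : ∀ᵐ x ∂K.siteMeasure, q x) (x : X) : q x := by
  unfold siteMeasure at h
  rw [Measure.ae_sum_iff] at h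
  have h1 := h x
  rw [Measure.ae_ennreal_smul_measure_iff 
    (ENNReal.ofReal_pos.2 (K.μ_pos x)).ne'] at h1
  simpa [ae_dirac_eq] using h1

theorem lintegral_siteMeasure (g : X → ℝ≥0∞) :
    ∫⁻ x, g x ∂K.siteMeasure = ∑' x, ENNReal.ofReal (K.μ x) * g x := by
  simp [siteMeasure, lintegral_sum_measure]

theorem lintegral_enorm_sq (f : X → ℂ) :
    eLpNorm f 2 K.siteMeasure = (∑' x, ENNReal.ofReal (K.μ x) * ‖f x‖ₑ ^ 2) ^ (1 / 2 : ℝ) := by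
  rw [eLpNorm_eq_lintegral_rpow_enorm_toReal (by norm_num) (by norm_num),
    ← lintegral_siteMeasure]
  simp

theorem tsum_sq_ne_top (f : K.ellTwo) : ∑' y, ENNReal.ofReal (K.μ y) * ‖f y‖ₑ ^ 2 ≠ ∞ := by
  intro h
  have h1 := (Lp.memLp f).eLpNorm_ne_top
  rw [lintegral_enorm_sq, h] at h1
  simp at h1

theorem summable_P_mul (f : K.ellTwo) (x : X) : Summable fun y => (K.P x y : ℂ) * f y := by
  have h1 : ∑' x, ENNReal.ofReal (K.μ x) * (∑' y, ‖(K.P x y : ℂ) * f y‖ₑ) ^ 2 ≠ ∞ :=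
    ne_top_of_le_ne_top (ENNReal.mul_ne_top (by norm_num) (K.tsum_sq_ne_top f)) (K.tsum_P_sq_le f)
  have h2 := ENNReal.ne_top_of_tsum_ne_top h1 x
  refine Summable.of_norm (tsum_enorm_ne_top_iff_summable_norm.1 fun h => h2 ?_)
  rw [h]
  simp [ENNReal.mul_top, K.μ_pos x]

theorem eLpNorm_fkFun_le (W : Potential X) {c : ℝ} (hc : 0 < c) (hV : ∀ x, c ≤ W.V x)
    (f : K.ellTwo) :
    eLpNorm (K.fkFun W f) 2 K.siteMeasure
      ≤ ENNReal.ofReal (c⁻¹ * Real.sqrt 2) * eLpNorm f 2 K.siteMeasure := by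
  have hx : ∀ x, ‖K.fkFun W f x‖ₑ ≤ ENNReal.ofReal c⁻¹ * ∑' y, ‖(K.P x y : ℂ) * f y‖ₑ :=
    fun x => by
      unfold fkFun
      rw [enorm_mul]
      gcongr
      · rw [← ofReal_norm, norm_inv, Complex.norm_real,
          Real.norm_of_nonneg (hc.le.trans (hV x))]
        exact ENNReal.ofReal_le_ofReal (inv_anti₀ hc (hV x))
      · exact enorm_tsum_le_tsum_enorm
  rw [lintegral_enorm_sq, lintegral_enorm_sq]
  have hk : ENNReal.ofReal (c⁻¹ * Real.sqrt 2)
      = (ENNReal.ofReal c⁻¹ ^ 2 * 2) ^ (1 / 2 : ℝ) := by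
    rw [ENNReal.mul_rpow_of_nonneg _ _ (by norm_num), ENNReal.ofReal_mul (by positivity),
      ← ENNReal.rpow_natCast, ← ENNReal.rpow_mul, Real.sqrt_eq_rpow,
      ← ENNReal.ofReal_rpow_of_pos (by norm_num)]
    norm_num
  rw [hk, ← ENNReal.mul_rpow_of_nonneg _ _ (by norm_num)]
  refine ENNReal.rpow_le_rpow ?_ (by norm_num)
  calc _ ≤ ∑' x, ENNReal.ofReal c⁻¹ ^ 2 *
          (ENNReal.ofReal (K.μ x) * (∑' y, ‖(K.P x y : ℂ) * f y‖ₑ) ^ 2) := by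
        refine ENNReal.tsum_le_tsum fun x => ?_
        calc _ ≤ ENNReal.ofReal (K.μ x) *
              (ENNReal.ofReal c⁻¹ * ∑' y, ‖(K.P x y : ℂ) * f y‖ₑ) ^ 2 := by
              gcongr; exact hx x
          _ = _ := by ring
    _ = ENNReal.ofReal c⁻¹ ^ 2 *
          ∑' x, (ENNReal.ofReal (K.μ x) * (∑' y, ‖(K.P x y : ℂ) * f y‖ₑ) ^ 2) :=
        ENNReal.tsum_mul_left
    _ ≤ ENNReal.ofReal c⁻¹ ^ 2 * (2 * ∑' y, ENNReal.ofReal (K.μ y) * ‖f y‖ₑ ^ 2) := by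
        gcongr; exact K.tsum_P_sq_le f
    _ = _ := by ring

theorem memLp_fkFun (W : Potential X) (f : K.ellTwo) :
    MemLp (K.fkFun W f) 2 K.siteMeasure := by
  obtain ⟨c, hc, hV⟩ := W.lowerBounded
  refine ⟨(Measurable.of_discrete).aestronglyMeasurable, ?_⟩
  exact (K.eLpNorm_fkFun_le W hc hV f).trans_lt
    (ENNReal.mul_lt_top ENNReal.ofReal_lt_top (Lp.memLp f).eLpNorm_lt_top)

theorem coe_eq {f : X → ℂ} (hf : MemLp f 2 K.siteMeasure) (x : X) : hf.toLp f x = f x :=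
  K.forall_of_ae hf.coeFn_toLp x

/-- The Feynman–Kac operator `𝒰` as a bounded operator on `ℓ²(X, μ)`. -/
def fkOperator (W : Potential X) : K.ellTwo →L[ℂ] K.ellTwo :=
  LinearMap.mkContinuousOfExistsBound
    { toFun := fun f => (K.memLp_fkFun W f).toLp (K.fkFun W f)
      map_add' := fun f g => by
        apply Lp.ext
        filter_upwards [Lp.coeFn_add ((K.memLp_fkFun W f).toLp (K.fkFun W f))
          ((K.memLp_fkFun W g).toLp (K.fkFun W g))] with x hx
        have h : ∀ y, (f + g) y = f y + g y := K.forall_of_ae (Lp.coeFn_add f g)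
        rw [hx, Pi.add_apply, coe_eq, coe_eq, coe_eq]
        unfold fkFun
        rw [← mul_add, ← (K.summable_P_mul f x).tsum_add (K.summable_P_mul g x)]
        exact congrArg _ (tsum_congr fun y => by rw [h y, mul_add])
      map_smul' := fun a f => by
        apply Lp.ext
        filter_upwards [Lp.coeFn_smul a ((K.memLp_fkFun W f).toLp (K.fkFun W f))] with x hx
        have h : ∀ y, (a • f) y = a * f y := K.forall_of_ae (Lp.coeFn_smul a f)
        rw [RingHom.id_apply, hx, Pi.smul_apply, coe_eq, coe_eq, smul_eq_mul]
        unfold fkFun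
        rw [mul_left_comm a, ← tsum_mul_left (a := a)]
        exact congrArg (fun t : ℂ => ((W.V x)⁻¹ : ℂ) * t)
          (tsum_congr fun y => by rw [h y, mul_left_comm a]) }
    (by
      obtain ⟨c, hc, hV⟩ := W.lowerBounded
      refine ⟨c⁻¹ * Real.sqrt 2, fun f => ?_⟩
      simp only [LinearMap.coe_mk, AddHom.coe_mk, Lp.norm_def]
      rw [eLpNorm_congr_ae (K.memLp_fkFun W f).coeFn_toLp,
        ← ENNReal.toReal_ofReal (show 0 ≤ c⁻¹ * Real.sqrt 2 by positivity),
        ← ENNReal.toReal_mul]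
      exact ENNReal.toReal_mono
        (ENNReal.mul_ne_top ENNReal.ofReal_ne_top (Lp.memLp f).eLpNorm_ne_top)
        (K.eLpNorm_fkFun_le W hc hV f))

theorem fkOperator_apply (W : Potential X) (f : K.ellTwo) (x : X) :
    K.fkOperator W f x = ((W.V x)⁻¹ : ℂ) * ∑' y, (K.P x y : ℂ) * f y :=
  K.coe_eq (K.memLp_fkFun W f) x

end Operator

/-- `λ₀ = sup {|λ| : λ ∈ σ(𝒰)}`, the spectral radius of `𝒰` on the complex space `ℓ²(X, μ)`. Here
`X` carries the discrete σ-algebra. -/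
def lam0 [Countable X] (W : Potential X) : ℝ :=
  letI : MeasurableSpace X := ⊤
  (spectralRadius ℂ (K.fkOperator W)).toReal

/-- `φ` is a ground state of `𝒰`: a strictly positive function with `‖φ‖_{ℓ²(μ)} = 1` and
`𝒰 φ = λ₀ φ`. -/
def IsGroundState [Countable X] (W : Potential X) (φ : X → ℝ) : Prop :=
  (∀ x, 0 < φ x) ∧ HasSum (fun x => φ x ^ 2 * K.μ x) 1 ∧
    ∀ x, HasSum (fun y => (W.V x)⁻¹ * (K.P x y * φ y)) (K.lam0 W * φ x)

/-- `φ` is a ground state of the dual operator `𝒰̂ f(x) = ∑_y Pd(x,y) V(y)⁻¹ f(y)`: a strictly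
positive function with `‖φ‖_{ℓ²(μ)} = 1` and `𝒰̂ φ = λ₀ φ`. -/
def IsDualGroundState [Countable X] (W : Potential X) (φ : X → ℝ) : Prop :=
  (∀ x, 0 < φ x) ∧ HasSum (fun x => φ x ^ 2 * K.μ x) 1 ∧
    ∀ x, HasSum (fun y => K.Pd x y * (W.V y)⁻¹ * φ y) (K.lam0 W * φ x)

end DualKernels

end FeynmanKac

end

/-! Everything is carried out with values in [0,∞] for T f = v·Pf, v = 1/V, so sums may be
rearranged freely; write t_n for the kernel of T^n with respect to counting measure, which is
u_n(x,y)μ(y).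

The engine is a tail estimate (`exists_tail`). If Λφ ≤ Tφ and v ≤ ε off a finite set S, then
Λ·T(1_{Sᶜ}φ) ≤ ε·v·PPφ ≤ εC·Tφ by the direct step property. For small ε the part of φ off S thus
contributes at most half of Tφ, hence Tφ ≤ 2T(1_S φ), and Tφ is dominated by a multiple of
v·P(·,x₀).

Ground states: 𝒰 is a norm limit of finite-rank operators, so it has an eigenvector f with |λ| = λ₀,
and g = |f| satisfies λ₀g ≤ Tg. If the inequality were strict at one point, h = Tg would satisfy Th
≥ (λ₀+δ)h, because a point perturbation spreads to a multiple of v·P(·,x₂), which dominates h; this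
contradicts `le_spectralRadius`. The same domination gives uniqueness. The dual side follows by
exchanging P and P̂, and pairing the two eigenfunctions shows that the eigenvalues agree.

Kernel bounds: let φ and ν = μφ̂ be the right and left eigenvectors. Keeping one term of an
eigenvalue equation gives the upper bound when x or y is in B. For the lower bound, T^nφ is compared
with T^n(1_S φ), ν with P(z,·), and the last jump is absorbed by the direct step property. For the
upper bound off B, paths meeting S are charged to the ground states (`exists_le_taboo`); those
avoiding S are reduced to two steps through a single site z with weight v(z)^{n-1}, at a factor 2C
per step (`tabooKernel_succ_le`). Monotonicity of V and laziness then restrict z to the range in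
F_n. Conversely, jumping to z, waiting there and jumping to y gives the lower bound by F_n. -/

noncomputable section

namespace FeynmanKac

variable {X : Type*}

/-! ### The operator v·P on [0,∞]-valued functions and its iterated kernels -/

/-- The operator `f ↦ v · P f` on nonnegative functions. -/
def stepOp (v : X → ℝ≥0∞) (P : X → X → ℝ≥0∞) (f : X → ℝ≥0∞) (x : X) : ℝ≥0∞ :=
  v x * ∑' y, P x y * f y

section StepOp

variable {v : X → ℝ≥0∞} {P : X → X → ℝ≥0∞}

theorem stepOp_mono : Monotone (stepOp v P) := fun f g h x => by
  unfold stepOp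
  gcongr with y
  exact h y

theorem stepOp_const_mul (c : ℝ≥0∞) (f : X → ℝ≥0∞) :
    stepOp v P (fun y => c * f y) = fun x => c * stepOp v P f x := by
  funext x
  unfold stepOp
  simp_rw [mul_left_comm _ c, ENNReal.tsum_mul_left]
  rw [mul_left_comm]

theorem stepOp_add (f g : X → ℝ≥0∞) :
    stepOp v P (fun y => f y + g y) = fun x => stepOp v P f x + stepOp v P g x := by
  funext x
  unfold stepOp
  simp_rw [mul_add, ENNReal.tsum_add, mul_add]

theorem stepOp_tsum {ι : Type*} (f : ι → X → ℝ≥0∞) :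
    stepOp v P (fun y => ∑' i, f i y) = fun x => ∑' i, stepOp v P (f i) x := by
  funext x
  unfold stepOp
  simp_rw [ENNReal.tsum_mul_left.symm]
  rw [ENNReal.tsum_comm]

theorem stepOp_iterate_mono (n : ℕ) : Monotone ((stepOp v P)^[n]) := stepOp_mono.iterate n

theorem stepOp_iterate_const_mul (n : ℕ) (c : ℝ≥0∞) (f : X → ℝ≥0∞) :
    (stepOp v P)^[n] (fun y => c * f y) = fun x => c * (stepOp v P)^[n] f x := by
  induction n generalizing f with
  | zero => rfl
  | succ n ih => simp only [Function.iterate_succ, Function.comp_apply, stepOp_const_mul, ih]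

theorem stepOp_iterate_tsum (n : ℕ) {ι : Type*} (f : ι → X → ℝ≥0∞) :
    (stepOp v P)^[n] (fun y => ∑' i, f i y) = fun x => ∑' i, (stepOp v P)^[n] (f i) x := by
  induction n generalizing f with
  | zero => rfl
  | succ n ih => simp only [Function.iterate_succ, Function.comp_apply, stepOp_tsum, ih]

theorem stepOp_iterate_eigen {Λ : ℝ≥0∞} {φ : X → ℝ≥0∞}
    (h : ∀ x, stepOp v P φ x = Λ * φ x) (n : ℕ) :
    (stepOp v P)^[n] φ = fun x => Λ ^ n * φ x := by
  induction n with
  | zero => simp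
  | succ n ih =>
    rw [Function.iterate_succ', Function.comp_apply, ih, stepOp_const_mul]
    funext x
    rw [h, pow_succ, mul_assoc]

theorem le_stepOp (f : X → ℝ≥0∞) (x y : X) : v x * P x y * f y ≤ stepOp v P f x := by
  unfold stepOp
  rw [mul_assoc]
  gcongr
  exact ENNReal.le_tsum y

/-- The kernel of the `(n+1)`-st power of `stepOp v P` with respect to counting measure. -/
def stepKernel (v : X → ℝ≥0∞) (P : X → X → ℝ≥0∞) (n : ℕ) (x y : X) : ℝ≥0∞ :=
  (stepOp v P)^[n] (fun x => v x * P x y) x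

@[simp] theorem stepKernel_zero (x y : X) : stepKernel v P 0 x y = v x * P x y := rfl

theorem stepKernel_succ (n : ℕ) (x y : X) :
    stepKernel v P (n + 1) x y = stepOp v P (fun z => stepKernel v P n z y) x := by
  unfold stepKernel
  rw [Function.iterate_succ', Function.comp_apply]

theorem stepOp_iterate_succ_eq_tsum (n : ℕ) (f : X → ℝ≥0∞) (x : X) :
    (stepOp v P)^[n + 1] f x = ∑' y, stepKernel v P n x y * f y := by
  have h : stepOp v P f = fun x => ∑' y, f y * (v x * P x y) := by
    funext x
    unfold stepOp
    rw [← ENNReal.tsum_mul_left]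
    exact tsum_congr fun y => by ring
  rw [Function.iterate_succ, Function.comp_apply, h, stepOp_iterate_tsum]
  simp only [stepOp_iterate_const_mul]
  exact tsum_congr fun y => mul_comm _ _

end StepOp

/-! ### Confined kernels: tail estimate and decay of subsolutions -/

/-- A strictly positive finite kernel `P` with the direct step property, together with a positive
weight `v` vanishing at infinity. -/
structure ConfinedKernel (v : X → ℝ≥0∞) (P : X → X → ℝ≥0∞) (C : ℝ≥0∞) : Prop where
  v_ne_zero : ∀ x, v x ≠ 0
  v_ne_top : ∀ x, v x ≠ ∞
  P_ne_zero : ∀ x y, P x y ≠ 0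
  P_ne_top : ∀ x y, P x y ≠ ∞
  C_ne_top : C ≠ ∞
  direct : ∀ x y, ∑' z, P x z * P z y ≤ C * P x y
  confining : ∀ ε : ℝ≥0∞, ε ≠ 0 → ∃ S : Finset X, ∀ x ∉ S, v x ≤ ε

namespace ConfinedKernel

variable {v : X → ℝ≥0∞} {P : X → X → ℝ≥0∞} {C : ℝ≥0∞}

/-- The hypotheses are symmetric in the two arguments of P, so estimates on right eigenfunctions
transfer to left ones. -/
theorem transpose (H : ConfinedKernel v P C) : ConfinedKernel v (fun x y => P y x) C where
  v_ne_zero := H.v_ne_zero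
  v_ne_top := H.v_ne_top
  P_ne_zero x y := H.P_ne_zero y x
  P_ne_top x y := H.P_ne_top y x
  C_ne_top := H.C_ne_top
  direct x y := by simpa only [mul_comm] using H.direct y x
  confining := H.confining

theorem P_mul_le (H : ConfinedKernel v P C) (x y z : X) : P x y * P y z ≤ C * P x z :=
  (ENNReal.le_tsum (f := fun y => P x y * P y z) y).trans (H.direct x z)

/-- Divide P(x,y)P(y,x₀) ≤ C·P(x,x₀) by P(y,x₀); summing the constants over S makes one serve every
y, uniformly in x. -/
theorem exists_P_le (H : ConfinedKernel v P C) (S : Finset X) (x₀ : X) :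
    ∃ D : ℝ≥0∞, D ≠ ∞ ∧ ∀ x, ∀ y ∈ S, P x y ≤ D * P x x₀ := by
  refine ⟨∑ y ∈ S, C / P y x₀, ?_, fun x y hy => ?_⟩
  · exact ENNReal.sum_ne_top.2 fun y _ => ENNReal.div_ne_top H.C_ne_top (H.P_ne_zero _ _)
  · calc P x y = P x y * P y x₀ / P y x₀ :=
          (ENNReal.mul_div_cancel_right (H.P_ne_zero _ _) (H.P_ne_top _ _)).symm
      _ ≤ C * P x x₀ / P y x₀ := ENNReal.div_le_div_right (H.P_mul_le _ _ _) _
      _ = C / P y x₀ * P x x₀ := by rw [ENNReal.mul_div_right_comm]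
      _ ≤ _ := by
        gcongr
        exact Finset.single_le_sum (f := fun y => C / P y x₀) (fun _ _ => zero_le) hy

/-- Outside a large finite set, a subsolution contributes at most half of its image. -/
theorem exists_tail (H : ConfinedKernel v P C) {Λ : ℝ≥0∞} (h0 : Λ ≠ 0) (ht : Λ ≠ ∞)
    (B : Finset X) :
    ∃ S : Finset X, B ⊆ S ∧ ∀ φ : X → ℝ≥0∞, (∀ x, Λ * φ x ≤ stepOp v P φ x) → ∀ x,
      stepOp v P ((S : Set X)ᶜ.indicator φ) x ≤ 2⁻¹ * stepOp v P φ x := by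
  classical
  -- This ε gives εC ≤ Λ/2; C + 1 replaces C to avoid dividing by zero.
  have hε : Λ / (2 * (C + 1)) ≠ 0 :=
    ENNReal.div_ne_zero.2 ⟨h0, ENNReal.mul_ne_top (by norm_num)
      (ENNReal.add_ne_top.2 ⟨H.C_ne_top, by norm_num⟩)⟩
  obtain ⟨S, hS⟩ := H.confining _ hε
  refine ⟨B ∪ S, Finset.subset_union_left, fun φ hφ x => ?_⟩
  set ε := Λ / (2 * (C + 1)) with hεd
  have hεC : ε * C ≤ Λ * 2⁻¹ := by
    calc ε * C ≤ ε * (C + 1) := by gcongr; exact le_self_add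
      _ = Λ * 2⁻¹ * ((C + 1)⁻¹ * (C + 1)) := by
        rw [hεd, div_eq_mul_inv, ENNReal.mul_inv (by simp) (by simp)]; ring
      _ = Λ * 2⁻¹ := by
        rw [ENNReal.inv_mul_cancel (by simp)
          (ENNReal.add_ne_top.2 ⟨H.C_ne_top, by norm_num⟩), mul_one]
  have hpt : ∀ y, Λ * ((↑(B ∪ S) : Set X)ᶜ.indicator φ y) ≤ ε * ∑' z, P y z * φ z := by
    intro y
    by_cases hy : y ∈ B ∪ S
    · rw [Set.indicator_of_notMem (Set.notMem_compl_iff.2 (Finset.mem_coe.2 hy)), mul_zero]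
      exact zero_le
    · rw [Set.indicator_of_mem (by simpa using hy)]
      refine (hφ y).trans ?_
      unfold stepOp
      gcongr
      exact hS y fun h => hy (Finset.mem_union_right _ h)
  -- Applying T to the pointwise bound produces a two-step sum, which the direct step property
  -- collapses to one step.
  have key : Λ * stepOp v P ((↑(B ∪ S) : Set X)ᶜ.indicator φ) x
      ≤ Λ * (2⁻¹ * stepOp v P φ x) := by
    calc _ = stepOp v P (fun y => Λ * ((↑(B ∪ S) : Set X)ᶜ.indicator φ y)) x := by
          rw [stepOp_const_mul]
      _ ≤ stepOp v P (fun y => ε * ∑' z, P y z * φ z) x := stepOp_mono hpt x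
      _ = ε * (v x * ∑' z, (∑' y, P x y * P y z) * φ z) := by
          rw [stepOp_const_mul]
          unfold stepOp
          simp_rw [← ENNReal.tsum_mul_left, ← ENNReal.tsum_mul_right]
          rw [ENNReal.tsum_comm]
          simp_rw [mul_assoc, ENNReal.tsum_mul_left]
      _ ≤ ε * (v x * ∑' z, (C * P x z) * φ z) := by
          gcongr with z
          exact H.direct x z
      _ = ε * C * stepOp v P φ x := by
          unfold stepOp
          simp_rw [mul_assoc, ENNReal.tsum_mul_left]
          ring
      _ ≤ Λ * 2⁻¹ * stepOp v P φ x := by gcongr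
      _ = _ := mul_assoc _ _ _
  exact (ENNReal.mul_le_mul_iff_right h0 ht).1 key

theorem stepOp_indicator_add (S : Set X) (φ : X → ℝ≥0∞) (x : X) :
    stepOp v P φ x = stepOp v P (S.indicator φ) x + stepOp v P (Sᶜ.indicator φ) x := by
  have h := congrFun (stepOp_add (v := v) (P := P) (S.indicator φ) (Sᶜ.indicator φ)) x
  rw [← h]
  congr 1
  funext y
  exact (congrFun (Set.indicator_self_add_compl S φ) y).symm

theorem le_two_mul_of_le_add_half {a b : ℝ≥0∞} (ha : a ≠ ∞) (h : a ≤ b + 2⁻¹ * a) :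
    a ≤ 2 * b := by
  have h1 : 2⁻¹ * a + 2⁻¹ * a = a := by
    rw [← add_mul, ENNReal.inv_two_add_inv_two, one_mul]
  have h2 : 2⁻¹ * a ≤ b := by
    have h3 : 2⁻¹ * a ≠ ∞ := ENNReal.mul_ne_top (by norm_num) ha
    rw [← ENNReal.add_le_add_iff_right h3, h1]
    exact h
  calc a = 2 * (2⁻¹ * a) := by
        rw [← mul_assoc, ENNReal.mul_inv_cancel (by norm_num) (by norm_num), one_mul]
    _ ≤ 2 * b := by gcongr

/-- The tail, at most half of Tφ, is moved to the left side, which needs Tφ finite. S depends on Λ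
but not on φ. -/
theorem exists_core (H : ConfinedKernel v P C) {Λ : ℝ≥0∞} (h0 : Λ ≠ 0) (ht : Λ ≠ ∞) :
    ∃ S : Finset X, ∀ φ : X → ℝ≥0∞, (∀ x, Λ * φ x ≤ stepOp v P φ x) →
      (∀ x, stepOp v P φ x ≠ ∞) → ∀ x,
      stepOp v P φ x ≤ 2 * stepOp v P ((S : Set X).indicator φ) x := by
  obtain ⟨S, -, hS⟩ := H.exists_tail h0 ht ∅
  refine ⟨S, fun φ hφ hfin x => le_two_mul_of_le_add_half (hfin x) ?_⟩
  conv_lhs => rw [stepOp_indicator_add (S : Set X) φ x]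
  gcongr
  exact hS φ hφ x

theorem ne_top_of_subsolution {Λ : ℝ≥0∞} (h0 : Λ ≠ 0) {φ : X → ℝ≥0∞}
    (hφ : ∀ x, Λ * φ x ≤ stepOp v P φ x) (hfin : ∀ x, stepOp v P φ x ≠ ∞) (x : X) :
    φ x ≠ ∞ := by
  intro h
  have := hφ x
  rw [h, ENNReal.mul_top h0, top_le_iff] at this
  exact hfin x this

/-- A subsolution is dominated by `v · P(·, x₀)`. -/
theorem exists_subsolution_le (H : ConfinedKernel v P C) {Λ : ℝ≥0∞} (h0 : Λ ≠ 0) (ht : Λ ≠ ∞)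
    {φ : X → ℝ≥0∞} (hφ : ∀ x, Λ * φ x ≤ stepOp v P φ x) (hfin : ∀ x, stepOp v P φ x ≠ ∞)
    (x₀ : X) :
    ∃ D : ℝ≥0∞, D ≠ ∞ ∧ ∀ x, stepOp v P φ x ≤ D * (v x * P x x₀) := by
  obtain ⟨S, hS⟩ := H.exists_core h0 ht
  obtain ⟨D, hD, hD'⟩ := H.exists_P_le S x₀
  refine ⟨2 * (D * ∑ y ∈ S, φ y), ?_, fun x => (hS φ hφ hfin x).trans ?_⟩
  · exact ENNReal.mul_ne_top (by norm_num) (ENNReal.mul_ne_top hD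
      (ENNReal.sum_ne_top.2 fun y _ => ne_top_of_subsolution h0 hφ hfin y))
  · unfold stepOp
    have : ∑' y, P x y * (S : Set X).indicator φ y = ∑ y ∈ S, P x y * φ y := by
      rw [tsum_eq_sum (s := S)]
      · exact Finset.sum_congr rfl fun y hy => by simp [hy]
      · intro y hy; simp [hy]
    rw [this]
    calc 2 * (v x * ∑ y ∈ S, P x y * φ y) ≤ 2 * (v x * ∑ y ∈ S, D * P x x₀ * φ y) := by
          gcongr with y hy
          exact hD' x y hy
      _ = _ := by rw [← Finset.mul_sum]; ring

theorem exists_eigen_le (H : ConfinedKernel v P C) {Λ : ℝ≥0∞} (h0 : Λ ≠ 0) (ht : Λ ≠ ∞)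
    {φ : X → ℝ≥0∞} (hφ : ∀ x, stepOp v P φ x = Λ * φ x) (hfin : ∀ x, φ x ≠ ∞) (x₀ : X) :
    ∃ D : ℝ≥0∞, D ≠ ∞ ∧ ∀ x, φ x ≤ D * (v x * P x x₀) := by
  obtain ⟨D, hD, h⟩ := H.exists_subsolution_le h0 ht (fun x => (hφ x).ge)
    (fun x => by rw [hφ]; exact ENNReal.mul_ne_top ht (hfin x)) x₀
  refine ⟨Λ⁻¹ * D, ENNReal.mul_ne_top (ENNReal.inv_ne_top.2 h0) hD, fun x => ?_⟩
  calc φ x = Λ⁻¹ * (Λ * φ x) := by rw [← mul_assoc, ENNReal.inv_mul_cancel h0 ht, one_mul]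
    _ ≤ Λ⁻¹ * (D * (v x * P x x₀)) := mul_le_mul_right ((hφ x).ge.trans (h x)) _
    _ = _ := (mul_assoc _ _ _).symm

/-- Serves the two strictness arguments: a surplus c at the single point x₀ adds c·v·P(·,x₀) after
one step, and this beats a fixed multiple of Tφ everywhere. -/
theorem exists_le_mul_of_subsolution (H : ConfinedKernel v P C) {Λ : ℝ≥0∞} (h0 : Λ ≠ 0)
    (ht : Λ ≠ ∞) {φ : X → ℝ≥0∞} (hφ : ∀ x, Λ * φ x ≤ stepOp v P φ x)
    (hfin : ∀ x, stepOp v P φ x ≠ ∞) (x₀ : X) {c : ℝ≥0∞} (hc : c ≠ 0) :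
    ∃ δ : ℝ≥0∞, δ ≠ 0 ∧ ∀ x, δ * stepOp v P φ x ≤ c * (v x * P x x₀) := by
  obtain ⟨D, hD, h⟩ := H.exists_subsolution_le h0 ht hφ hfin x₀
  refine ⟨c / (D + 1), ENNReal.div_ne_zero.2 ⟨hc, ENNReal.add_ne_top.2 ⟨hD, by norm_num⟩⟩,
    fun x => ?_⟩
  calc c / (D + 1) * stepOp v P φ x ≤ c / (D + 1) * ((D + 1) * (v x * P x x₀)) := by
        gcongr
        exact (h x).trans (by gcongr; exact le_self_add)
    _ = _ := by
      rw [← mul_assoc, ENNReal.div_mul_cancel (by simp) (ENNReal.add_ne_top.2 ⟨hD, by norm_num⟩)]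

end ConfinedKernel

/-! ### Eigenpairs and the ground state bounds on the kernel -/

/-- A right eigenfunction `φ` and a left eigenmeasure `ν` of `stepOp v P` with eigenvalue `Λ`,
all strictly positive and finite. -/
structure EigenPair (v : X → ℝ≥0∞) (P : X → X → ℝ≥0∞) (Λ : ℝ≥0∞) (φ ν : X → ℝ≥0∞) : Prop where
  Λ_ne_zero : Λ ≠ 0
  Λ_ne_top : Λ ≠ ∞
  φ_ne_zero : ∀ x, φ x ≠ 0
  φ_ne_top : ∀ x, φ x ≠ ∞
  ν_ne_zero : ∀ x, ν x ≠ 0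
  ν_ne_top : ∀ x, ν x ≠ ∞
  right : ∀ x, stepOp v P φ x = Λ * φ x
  left : ∀ y, ∑' x, ν x * (v x * P x y) = Λ * ν y

theorem tsum_left_eigen_mul_stepOp {v : X → ℝ≥0∞} {P : X → X → ℝ≥0∞} {Λ : ℝ≥0∞}
    {ν : X → ℝ≥0∞} (hν : ∀ y, ∑' x, ν x * (v x * P x y) = Λ * ν y) (f : X → ℝ≥0∞) :
    ∑' x, ν x * stepOp v P f x = Λ * ∑' x, ν x * f x := by
  calc ∑' x, ν x * stepOp v P f x = ∑' x, ∑' y, ν x * (v x * P x y) * f y := by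
        refine tsum_congr fun x => ?_
        unfold stepOp
        simp_rw [mul_assoc, ENNReal.tsum_mul_left]
    _ = ∑' y, Λ * (ν y * f y) := by
        rw [ENNReal.tsum_comm]
        refine tsum_congr fun y => ?_
        rw [ENNReal.tsum_mul_right, hν, mul_assoc]
    _ = _ := ENNReal.tsum_mul_left

namespace ConfinedKernel

variable {v : X → ℝ≥0∞} {P : X → X → ℝ≥0∞} {C Λ : ℝ≥0∞} {φ ν : X → ℝ≥0∞}

/-- A left eigenmeasure is dominated by `P(x₀, ·)`. -/
theorem exists_left_eigen_le (H : ConfinedKernel v P C) (E : EigenPair v P Λ φ ν) (x₀ : X) :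
    ∃ D : ℝ≥0∞, D ≠ ∞ ∧ ∀ y, ν y ≤ D * P x₀ y := by
  -- If ν is a left eigenmeasure, then vν is a right eigenfunction for the transposed kernel.
  obtain ⟨D, hD, h⟩ := H.transpose.exists_eigen_le (φ := fun x => v x * ν x)
    E.Λ_ne_zero E.Λ_ne_top (fun x => by
      unfold stepOp
      have : ∑' y, P y x * (v y * ν y) = Λ * ν x := by
        rw [← E.left x]
        exact tsum_congr fun y => by ring
      rw [this]
      ring) (fun x => ENNReal.mul_ne_top (H.v_ne_top x) (E.ν_ne_top x)) x₀
  refine ⟨D, hD, fun y => ?_⟩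
  have := h y
  rw [mul_left_comm] at this
  exact (ENNReal.mul_le_mul_iff_right (H.v_ne_zero y) (H.v_ne_top y)).1 this

/-- Only the last jump is affected: P(w,y)P(y,z) ≤ C·P(w,z), and the first n steps preserve the
inequality by monotonicity. -/
theorem stepKernel_mul_le (H : ConfinedKernel v P C) (n : ℕ) (x y z : X) :
    stepKernel v P n x y * P y z ≤ C * stepKernel v P n x z := by
  unfold stepKernel
  have h1 := congrFun (stepOp_iterate_const_mul (v := v) (P := P) n (P y z)
    (fun w => v w * P w y)) x
  have h2 := congrFun (stepOp_iterate_const_mul (v := v) (P := P) n C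
    (fun w => v w * P w z)) x
  rw [mul_comm, ← h1, ← h2]
  refine stepOp_iterate_mono n (fun w => ?_) x
  calc P y z * (v w * P w y) = v w * (P w y * P y z) := by ring
    _ ≤ v w * (C * P w z) := mul_le_mul_right (H.P_mul_le _ _ _) _
    _ = _ := by ring

theorem stepKernel_mul_right_le (E : EigenPair v P Λ φ ν) (n : ℕ) (x y : X) :
    stepKernel v P n x y * φ y ≤ Λ ^ (n + 1) * φ x := by
  rw [← congrFun (stepOp_iterate_eigen E.right (n + 1)) x, stepOp_iterate_succ_eq_tsum]
  exact ENNReal.le_tsum y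

theorem left_mul_stepKernel_le (E : EigenPair v P Λ φ ν) (n : ℕ) (x y : X) :
    ν x * stepKernel v P n x y ≤ Λ ^ (n + 1) * ν y := by
  have h : ∀ n, ∑' x, ν x * stepKernel v P n x y = Λ ^ (n + 1) * ν y := fun n => by
    induction n with
    | zero => simp [E.left]
    | succ n ih =>
      simp_rw [stepKernel_succ]
      rw [tsum_left_eigen_mul_stepOp E.left, ih, pow_succ Λ (n + 1)]
      ring
  rw [← h]
  exact ENNReal.le_tsum x

/-- Upper bound when one of the two points lies in a given finite set. -/
theorem exists_upper_of_mem (E : EigenPair v P Λ φ ν) (B : Finset X) :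
    ∃ D : ℝ≥0∞, D ≠ ∞ ∧ ∀ n x y, (x ∈ B ∨ y ∈ B) →
      stepKernel v P n x y ≤ D * (Λ ^ (n + 1) * φ x * ν y) := by
  have hne : ∀ z, φ z * ν z ≠ 0 := fun z => mul_ne_zero (E.φ_ne_zero z) (E.ν_ne_zero z)
  have hnt : ∀ z, φ z * ν z ≠ ∞ := fun z => ENNReal.mul_ne_top (E.φ_ne_top z) (E.ν_ne_top z)
  have key : ∀ z ∈ B, ∀ a b : ℝ≥0∞, φ z * ν z * a ≤ b →
      a ≤ (∑ z ∈ B, (φ z * ν z)⁻¹) * b := fun z hz a b hab => by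
    calc a = (φ z * ν z)⁻¹ * (φ z * ν z * a) := by
          rw [← mul_assoc, ENNReal.inv_mul_cancel (hne z) (hnt z), one_mul]
      _ ≤ _ := mul_le_mul' (Finset.single_le_sum (f := fun z => (φ z * ν z)⁻¹)
          (fun _ _ => zero_le) hz) hab
  refine ⟨∑ z ∈ B, (φ z * ν z)⁻¹,
    ENNReal.sum_ne_top.2 fun z _ => ENNReal.inv_ne_top.2 (hne z), fun n x y hxy => ?_⟩
  rcases hxy with hx | hy
  · refine key x hx _ _ ?_
    calc φ x * ν x * stepKernel v P n x y = φ x * (ν x * stepKernel v P n x y) := mul_assoc _ _ _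
      _ ≤ φ x * (Λ ^ (n + 1) * ν y) := mul_le_mul_right (left_mul_stepKernel_le E n x y) _
      _ = _ := by ring
  · refine key y hy _ _ ?_
    calc φ y * ν y * stepKernel v P n x y = (stepKernel v P n x y * φ y) * ν y := by ring
      _ ≤ Λ ^ (n + 1) * φ x * ν y := mul_le_mul_left (stepKernel_mul_right_le E n x y) _

/-- Global lower bound by the ground states. -/
theorem exists_lower (H : ConfinedKernel v P C) (E : EigenPair v P Λ φ ν) :
    ∃ D : ℝ≥0∞, D ≠ ∞ ∧ ∀ n x y, Λ ^ (n + 1) * φ x * ν y ≤ D * stepKernel v P n x y := by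
  obtain ⟨S, hS⟩ := H.exists_core E.Λ_ne_zero E.Λ_ne_top
  have hcore := hS φ (fun x => (E.right x).ge)
    (fun x => by rw [E.right]; exact ENNReal.mul_ne_top E.Λ_ne_top (E.φ_ne_top x))
  choose D hD hνD using H.exists_left_eigen_le E
  refine ⟨2 * ∑ z ∈ S, D z * C * φ z, ENNReal.mul_ne_top (by norm_num)
    (ENNReal.sum_ne_top.2 fun z _ => ENNReal.mul_ne_top
      (ENNReal.mul_ne_top (hD z) H.C_ne_top) (E.φ_ne_top z)), fun n x y => ?_⟩
  -- The core inequality is used at the innermost of the n + 1 applications of T, which confines the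
  -- endpoint z to S.
  have h1 : Λ ^ (n + 1) * φ x ≤ 2 * ∑ z ∈ S, stepKernel v P n x z * φ z := by
    calc Λ ^ (n + 1) * φ x = (stepOp v P)^[n + 1] φ x :=
          (congrFun (stepOp_iterate_eigen E.right (n + 1)) x).symm
      _ = (stepOp v P)^[n] (stepOp v P φ) x := rfl
      _ ≤ (stepOp v P)^[n] (fun x => 2 * stepOp v P ((S : Set X).indicator φ) x) x :=
          stepOp_iterate_mono n hcore x
      _ = 2 * (stepOp v P)^[n + 1] ((S : Set X).indicator φ) x := by
          rw [stepOp_iterate_const_mul]; rfl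
      _ = _ := by
          rw [stepOp_iterate_succ_eq_tsum, tsum_eq_sum (s := S)]
          · congr 1
            exact Finset.sum_congr rfl fun z hz => by simp [hz]
          · intro z hz; simp [hz]
  calc Λ ^ (n + 1) * φ x * ν y ≤ 2 * (∑ z ∈ S, stepKernel v P n x z * φ z) * ν y :=
        mul_le_mul_left h1 _
    _ = 2 * ∑ z ∈ S, stepKernel v P n x z * φ z * ν y := by rw [mul_assoc, Finset.sum_mul]
    _ ≤ 2 * ∑ z ∈ S, D z * C * φ z * stepKernel v P n x y := by
        refine mul_le_mul_right (Finset.sum_le_sum fun z _ => ?_) _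
        calc stepKernel v P n x z * φ z * ν y ≤ stepKernel v P n x z * φ z * (D z * P z y) :=
              mul_le_mul_right (hνD z y) _
          _ = D z * φ z * (stepKernel v P n x z * P z y) := by ring
          _ ≤ D z * φ z * (C * stepKernel v P n x y) :=
              mul_le_mul_right (H.stepKernel_mul_le n x z y) _
          _ = _ := by ring
    _ = _ := by rw [← Finset.sum_mul, mul_assoc]

end ConfinedKernel

/-! ### Taboo kernels and the two-step term -/

/-- The kernel of paths of length `n + 1` whose intermediate points avoid `S`. -/
def tabooKernel (v : X → ℝ≥0∞) (P : X → X → ℝ≥0∞) (S : Set X) : ℕ → X → X → ℝ≥0∞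
  | 0 => fun x y => v x * P x y
  | n + 1 => fun x y => stepOp v P (Sᶜ.indicator fun z => tabooKernel v P S n z y) x

namespace ConfinedKernel

variable {v : X → ℝ≥0∞} {P : X → X → ℝ≥0∞} {C Λ : ℝ≥0∞} {φ ν : X → ℝ≥0∞}

/-- Induction on the first jump. Landing in S costs A times the ground state term; landing off S
costs, besides the taboo kernel, 2A times that term, halved by the tail estimate. Since A + 2A/2 =
2A, the constant does not grow with n. -/
theorem exists_le_taboo (H : ConfinedKernel v P C) (E : EigenPair v P Λ φ ν) (B : Finset X) :
    ∃ S : Finset X, B ⊆ S ∧ ∃ D : ℝ≥0∞, D ≠ ∞ ∧ ∀ n x y,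
      stepKernel v P n x y ≤ tabooKernel v P S n x y + D * (Λ ^ (n + 1) * φ x * ν y) := by
  obtain ⟨S, hBS, hS⟩ := H.exists_tail E.Λ_ne_zero E.Λ_ne_top B
  obtain ⟨A, hA, hupper⟩ := exists_upper_of_mem E S
  have htail := hS φ fun x => (E.right x).ge
  refine ⟨S, hBS, 2 * A, ENNReal.mul_ne_top (by norm_num) hA, fun n => ?_⟩
  induction n with
  | zero => exact fun x y => le_self_add
  | succ n ih =>
    intro x y
    rw [stepKernel_succ, stepOp_indicator_add (S : Set X)]
    have h1 : stepOp v P ((S : Set X).indicator fun z => stepKernel v P n z y) x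
        ≤ A * (Λ ^ (n + 2) * φ x * ν y) := by
      calc _ ≤ stepOp v P (fun z => A * Λ ^ (n + 1) * ν y * φ z) x := by
            refine stepOp_mono (fun z => ?_) x
            by_cases hz : z ∈ S
            · rw [Set.indicator_of_mem (Finset.mem_coe.2 hz)]
              exact (hupper n z y (Or.inl hz)).trans_eq (by ring)
            · rw [Set.indicator_of_notMem (fun h => hz (Finset.mem_coe.1 h))]
              exact zero_le
        _ = _ := by
            rw [stepOp_const_mul]
            simp only [E.right]
            ring
    have h2 : stepOp v P ((S : Set X)ᶜ.indicator fun z => stepKernel v P n z y) x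
        ≤ tabooKernel v P S (n + 1) x y + A * (Λ ^ (n + 2) * φ x * ν y) := by
      calc _ ≤ stepOp v P (fun z => ((S : Set X)ᶜ.indicator fun z => tabooKernel v P S n z y) z
              + 2 * A * Λ ^ (n + 1) * ν y * (S : Set X)ᶜ.indicator φ z) x := by
            refine stepOp_mono (fun z => ?_) x
            by_cases hz : z ∈ (S : Set X)ᶜ
            · simp only [Set.indicator_of_mem hz]
              exact (ih z y).trans_eq (by ring)
            · simp only [Set.indicator_of_notMem hz]
              exact zero_le
        _ = tabooKernel v P S (n + 1) x y
              + 2 * A * Λ ^ (n + 1) * ν y * stepOp v P ((S : Set X)ᶜ.indicator φ) x := by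
            rw [stepOp_add, stepOp_const_mul]; rfl
        _ ≤ tabooKernel v P S (n + 1) x y
              + 2 * A * Λ ^ (n + 1) * ν y * (2⁻¹ * (Λ * φ x)) := by
            rw [← E.right]
            exact add_le_add_right (mul_le_mul_right (htail x) _) _
        _ = tabooKernel v P S (n + 1) x y
              + 2 * 2⁻¹ * (A * (Λ ^ (n + 2) * φ x * ν y)) := by ring
        _ = _ := by rw [ENNReal.mul_inv_cancel (by norm_num) (by norm_num), one_mul]
    exact (add_le_add h1 h2).trans_eq (by ring)

theorem mul_pow_succ_le (a b : ℝ≥0∞) (n : ℕ) : a * b ^ n ≤ a ^ (n + 1) + b ^ (n + 1) := by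
  rcases le_total a b with h | h
  · calc a * b ^ n ≤ b * b ^ n := by gcongr
      _ = b ^ (n + 1) := by ring
      _ ≤ _ := le_add_self
  · calc a * b ^ n ≤ a * a ^ n := by gcongr
      _ = a ^ (n + 1) := by ring
      _ ≤ _ := le_self_add

/-- Bounding a(w)a(z)^n by a(w)^{n+1} + a(z)^{n+1} leaves one of the two sites without weight in
each summand; summing it out by the direct step property costs C, hence 2C in total. -/
theorem tsum_mul_two_step_le (H : ConfinedKernel v P C) (a : X → ℝ≥0∞) (n : ℕ) (x y : X) :
    ∑' w, P x w * (a w * ∑' z, P w z * P z y * a z ^ n)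
      ≤ 2 * C * ∑' z, P x z * P z y * a z ^ (n + 1) := by
  calc _ = ∑' w, ∑' z, P x w * P w z * P z y * (a w * a z ^ n) := by
        refine tsum_congr fun w => ?_
        rw [← ENNReal.tsum_mul_left, ← ENNReal.tsum_mul_left]
        exact tsum_congr fun z => by ring
    _ ≤ ∑' w, ∑' z, (P x w * a w ^ (n + 1) * (P w z * P z y)
          + (P x w * P w z) * (P z y * a z ^ (n + 1))) := by
        refine ENNReal.tsum_le_tsum fun w => ENNReal.tsum_le_tsum fun z => ?_
        exact (mul_le_mul_right (mul_pow_succ_le _ _ _) _).trans_eq (by ring)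
    _ = (∑' w, P x w * a w ^ (n + 1) * ∑' z, P w z * P z y)
          + ∑' z, (∑' w, P x w * P w z) * (P z y * a z ^ (n + 1)) := by
        simp_rw [ENNReal.tsum_add, ENNReal.tsum_mul_left]
        congr 1
        rw [ENNReal.tsum_comm]
        simp_rw [ENNReal.tsum_mul_right]
    _ ≤ (∑' w, P x w * a w ^ (n + 1) * (C * P w y))
          + ∑' z, (C * P x z) * (P z y * a z ^ (n + 1)) := by
        refine add_le_add (ENNReal.tsum_le_tsum fun w => mul_le_mul_right (H.direct w y) _)
          (ENNReal.tsum_le_tsum fun z => mul_le_mul_left (H.direct x z) _)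
    _ = _ := by
        rw [← ENNReal.tsum_add, ← ENNReal.tsum_mul_left]
        exact tsum_congr fun z => by ring

/-- With one intermediate site this is an equality; each further step merges two weighted sites into
one at a factor 2C. -/
theorem tabooKernel_succ_le (H : ConfinedKernel v P C) (S : Set X) (n : ℕ) (x y : X) :
    tabooKernel v P S (n + 1) x y
      ≤ (2 * C) ^ n * (v x * ∑' z, P x z * P z y * Sᶜ.indicator v z ^ (n + 1)) := by
  induction n generalizing x with
  | zero =>
    refine le_of_eq ?_
    simp only [tabooKernel, stepOp, pow_zero, one_mul, zero_add, pow_one]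
    congr 1
    refine tsum_congr fun z => ?_
    rw [Set.indicator_mul_left]
    ring
  | succ n ih =>
    calc tabooKernel v P S (n + 2) x y
        ≤ stepOp v P (fun w => (2 * C) ^ n * (Sᶜ.indicator v w *
            ∑' z, P w z * P z y * Sᶜ.indicator v z ^ (n + 1))) x := by
          refine stepOp_mono (fun w => ?_) x
          by_cases hw : w ∈ Sᶜ
          · rw [Set.indicator_of_mem hw, Set.indicator_of_mem hw]
            exact ih w
          · rw [Set.indicator_of_notMem hw]
            exact zero_le
      _ = (2 * C) ^ n * (v x * ∑' w, P x w * (Sᶜ.indicator v w *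
            ∑' z, P w z * P z y * Sᶜ.indicator v z ^ (n + 1))) := by
          rw [stepOp_const_mul]; rfl
      _ ≤ (2 * C) ^ n * (v x * (2 * C * ∑' z, P x z * P z y * Sᶜ.indicator v z ^ (n + 2))) :=
          mul_le_mul_right (mul_le_mul_right (H.tsum_mul_two_step_le _ _ _ _) _) _
      _ = _ := by ring

/-- The two-step sum over `z ∉ B` with `α z ≤ α x` and `α z ≤ α y` dominates its term at
whichever of `x`, `y` has the smaller `α`. -/
theorem mul_le_tsum_indicator {B : Set X} {α : X → ℕ} {Cm : ℝ≥0∞} (hCm : ∀ x, Cm ≤ P x x)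
    {x y m : X} (hm : m = x ∨ m = y) (hmB : m ∉ B) (hmx : α m ≤ α x) (hmy : α m ≤ α y)
    (n : ℕ) :
    Cm * (P x y * v m ^ n)
      ≤ ∑' z, {z | z ∉ B ∧ α z ≤ α x ∧ α z ≤ α y}.indicator
          (fun z => P x z * P z y * v z ^ n) z := by
  refine le_trans ?_ (ENNReal.le_tsum m)
  rw [Set.indicator_of_mem (show m ∈ {z | z ∉ B ∧ α z ≤ α x ∧ α z ≤ α y} from ⟨hmB, hmx, hmy⟩)]
  rw [← mul_assoc]
  refine mul_le_mul_left ?_ _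
  rcases hm with rfl | rfl
  · exact mul_le_mul_left (hCm m) _
  · rw [mul_comm]; exact mul_le_mul_right (hCm m) _

/-- Let m be whichever of x, y has the smaller α. Sites off S outside the allowed range have v(z) ≤
v(m), so together they give at most C·P(x,y)v(m)^{n+1}; by laziness the allowed term z = m recovers
this up to the factor Cm⁻¹. -/
theorem two_step_tsum_le (H : ConfinedKernel v P C) {B S : Set X} (hBS : B ⊆ S) {α : X → ℕ}
    (hα : ∀ x y, α x < α y → v y ≤ v x) {Cm : ℝ≥0∞} (hCm : ∀ x, Cm ≤ P x x) (hCm0 : Cm ≠ 0)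
    (hCmt : Cm ≠ ∞) {x y : X} (hx : x ∉ B) (hy : y ∉ B) (n : ℕ) :
    ∑' z, P x z * P z y * Sᶜ.indicator v z ^ (n + 1)
      ≤ (1 + C * Cm⁻¹) * ∑' z, {z | z ∉ B ∧ α z ≤ α x ∧ α z ≤ α y}.indicator
          (fun z => P x z * P z y * v z ^ (n + 1)) z := by
  obtain ⟨m, hm, hmB, hmx, hmy, hmin⟩ : ∃ m, (m = x ∨ m = y) ∧ m ∉ B ∧ α m ≤ α x ∧ α m ≤ α y ∧
      ∀ z, ¬ (α z ≤ α x ∧ α z ≤ α y) → α m < α z := by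
    rcases le_total (α x) (α y) with h | h
    · exact ⟨x, Or.inl rfl, hx, le_rfl, h, fun z hz => by omega⟩
    · exact ⟨y, Or.inr rfl, hy, h, le_rfl, fun z hz => by omega⟩
  set I : Set X := {z | z ∉ B ∧ α z ≤ α x ∧ α z ≤ α y} with hI
  calc ∑' z, P x z * P z y * Sᶜ.indicator v z ^ (n + 1)
      ≤ ∑' z, (I.indicator (fun z => P x z * P z y * v z ^ (n + 1)) z
          + P x z * P z y * v m ^ (n + 1)) := by
        refine ENNReal.tsum_le_tsum fun z => ?_
        by_cases hz : z ∈ Sᶜ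
        · rw [Set.indicator_of_mem hz]
          by_cases hzI : z ∈ I
          · rw [Set.indicator_of_mem hzI]
            exact le_self_add
          · refine le_trans ?_ le_add_self
            have : α m < α z := hmin z fun h => hzI ⟨fun hB => hz (hBS hB), h⟩
            gcongr
            exact hα _ _ this
        · rw [Set.indicator_of_notMem hz]
          simp
    _ ≤ (∑' z, I.indicator (fun z => P x z * P z y * v z ^ (n + 1)) z)
          + C * (P x y * v m ^ (n + 1)) := by
        rw [ENNReal.tsum_add, ENNReal.tsum_mul_right, ← mul_assoc]
        exact add_le_add_right (mul_le_mul_left (H.direct x y) _) _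
    _ = (∑' z, I.indicator (fun z => P x z * P z y * v z ^ (n + 1)) z)
          + C * Cm⁻¹ * (Cm * (P x y * v m ^ (n + 1))) := by
        congr 1
        rw [mul_assoc C, ← mul_assoc Cm⁻¹, ENNReal.inv_mul_cancel hCm0 hCmt, one_mul]
    _ ≤ _ := by
        rw [add_mul, one_mul]
        exact add_le_add_right
          (mul_le_mul_right (mul_le_tsum_indicator hCm hm hmB hmx hmy _) _) _

/-- Upper bound by the ground states and the two-step term. -/
theorem exists_upper (H : ConfinedKernel v P C) (E : EigenPair v P Λ φ ν) (B : Finset X)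
    {α : X → ℕ} (hα : ∀ x y, α x < α y → v y ≤ v x) {Cm : ℝ≥0∞} (hCm : ∀ x, Cm ≤ P x x)
    (hCm0 : Cm ≠ 0) (hCmt : Cm ≠ ∞) {Cup : ℝ≥0∞} (hup1 : 1 ≤ Cup) (hup : 2 * C ≤ Cup) :
    ∃ D : ℝ≥0∞, D ≠ ∞ ∧ ∀ n, ∀ x ∉ B, ∀ y ∉ B,
      stepKernel v P n x y ≤ D * (Λ ^ (n + 1) * φ x * ν y + Cup ^ (n + 1) *
        (v x * ∑' z, {z | z ∉ (B : Set X) ∧ α z ≤ α x ∧ α z ≤ α y}.indicator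
          (fun z => P x z * P z y * v z ^ n) z)) := by
  obtain ⟨S, hBS, D, hD, h⟩ := H.exists_le_taboo E B
  have hinv : Cm⁻¹ ≠ ∞ := ENNReal.inv_ne_top.2 hCm0
  refine ⟨D + (1 + C * Cm⁻¹ + Cm⁻¹), ENNReal.add_ne_top.2 ⟨hD, ENNReal.add_ne_top.2
    ⟨ENNReal.add_ne_top.2 ⟨by norm_num, ENNReal.mul_ne_top H.C_ne_top hinv⟩, hinv⟩⟩,
    fun n x hx y hy => ?_⟩
  set G := Cup ^ (n + 1) * (v x * ∑' z, {z | z ∉ (B : Set X) ∧ α z ≤ α x ∧ α z ≤ α y}.indicator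
          (fun z => P x z * P z y * v z ^ n) z) with hG
  have htaboo : tabooKernel v P S n x y ≤ (1 + C * Cm⁻¹ + Cm⁻¹) * G := by
    -- A single step has no intermediate site to sum over, so v·P is compared directly with the term
    -- z = m; this is the source of the extra Cm⁻¹ in the constant.
    cases n with
    | zero =>
      obtain ⟨m, hm, hmB, hmx, hmy⟩ : ∃ m, (m = x ∨ m = y) ∧ m ∉ (B : Set X) ∧ α m ≤ α x ∧
          α m ≤ α y := by
        rcases le_total (α x) (α y) with h | h
        · exact ⟨x, Or.inl rfl, hx, le_rfl, h⟩
        · exact ⟨y, Or.inr rfl, hy, h, le_rfl⟩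
      have h1 := mul_le_tsum_indicator (v := v) hCm hm hmB hmx hmy 0
      calc tabooKernel v P S 0 x y = Cm⁻¹ * (1 * (v x * (Cm * (P x y * v m ^ 0)))) := by
            rw [pow_zero, mul_one, one_mul, mul_left_comm (v x), ← mul_assoc Cm⁻¹,
              ENNReal.inv_mul_cancel hCm0 hCmt, one_mul]
            rfl
        _ ≤ (1 + C * Cm⁻¹ + Cm⁻¹) * G := by
            refine mul_le_mul' le_add_self (mul_le_mul' (one_le_pow₀ hup1) ?_)
            exact mul_le_mul_right h1 _
    | succ n =>
      calc tabooKernel v P S (n + 1) x y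
          ≤ (2 * C) ^ n * (v x * ∑' z, P x z * P z y * (S : Set X)ᶜ.indicator v z ^ (n + 1)) :=
            H.tabooKernel_succ_le _ _ _ _
        _ ≤ Cup ^ (n + 2) * (v x * ((1 + C * Cm⁻¹) *
              ∑' z, {z | z ∉ (B : Set X) ∧ α z ≤ α x ∧ α z ≤ α y}.indicator
                (fun z => P x z * P z y * v z ^ (n + 1)) z)) := by
            refine mul_le_mul' ?_ (mul_le_mul_right
              (H.two_step_tsum_le (Finset.coe_subset.2 hBS) hα hCm hCm0 hCmt hx hy n) _)
            exact (pow_le_pow_left₀ zero_le hup n).trans (pow_le_pow_right₀ hup1 (by omega))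
        _ = (1 + C * Cm⁻¹) * G := by rw [hG]; ring
        _ ≤ _ := mul_le_mul_left le_self_add _
  calc stepKernel v P n x y ≤ tabooKernel v P S n x y + D * (Λ ^ (n + 1) * φ x * ν y) := h n x y
    _ ≤ (D + (1 + C * Cm⁻¹ + Cm⁻¹)) * G
        + (D + (1 + C * Cm⁻¹ + Cm⁻¹)) * (Λ ^ (n + 1) * φ x * ν y) :=
      add_le_add (htaboo.trans (mul_le_mul_left le_add_self _)) (mul_le_mul_left le_self_add _)
    _ = _ := by rw [mul_add, add_comm]

/-- Lower bound by the two-step term. -/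
theorem two_step_le_stepKernel (H : ConfinedKernel v P C) {Cl : ℝ≥0∞} (hl1 : Cl ≤ 1)
    (hlC : Cl * C ≤ 1) (hl : ∀ x, Cl ≤ P x x) (I : Set X) (n : ℕ) (x y : X) :
    Cl ^ (n + 1) * (v x * ∑' z, I.indicator (fun z => P x z * P z y * v z ^ n) z)
      ≤ stepKernel v P n x y := by
  -- For one step the sum is at most C·P(x,y), and Cl·C ≤ 1 suffices.
  cases n with
  | zero =>
    calc _ ≤ Cl ^ 1 * (v x * ∑' z, P x z * P z y) := by
          refine mul_le_mul_right (mul_le_mul_right (ENNReal.tsum_le_tsum fun z => ?_) _) _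
          simpa using Set.indicator_le_self I (fun z => P x z * P z y) z
      _ ≤ Cl * (v x * (C * P x y)) := by
          rw [pow_one]
          exact mul_le_mul_right (mul_le_mul_right (H.direct x y) _) _
      _ = Cl * C * (v x * P x y) := by ring
      _ ≤ 1 * (v x * P x y) := mul_le_mul_left hlC _
      _ = _ := one_mul _
  | succ n =>
    -- Keep only the path that waits n times at z and then jumps to y. A further first jump x → z
    -- gives n + 2 steps in all, and the two unused powers of Cl are dropped since Cl ≤ 1.
    have hdiag : ∀ (n : ℕ) z, Cl ^ n * (v z ^ (n + 1) * P z y) ≤ stepKernel v P n z y := by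
      intro n z
      induction n with
      | zero => simp
      | succ n ih =>
        rw [stepKernel_succ]
        calc _ = v z * Cl * (Cl ^ n * (v z ^ (n + 1) * P z y)) := by ring
          _ ≤ v z * P z z * stepKernel v P n z y :=
            mul_le_mul' (mul_le_mul_right (hl z) _) ih
          _ ≤ _ := le_stepOp (fun z => stepKernel v P n z y) z z
    calc _ ≤ Cl ^ n * (v x * ∑' z, P x z * P z y * v z ^ (n + 1)) := by
          refine mul_le_mul' (pow_le_pow_of_le_one zero_le hl1 (by omega))
            (mul_le_mul_right (ENNReal.tsum_le_tsum fun z => ?_) _)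
          exact Set.indicator_le_self I (fun z => P x z * P z y * v z ^ (n + 1)) z
      _ = stepOp v P (fun z => Cl ^ n * (v z ^ (n + 1) * P z y)) x := by
          rw [stepOp_const_mul]
          exact congrArg (fun t => Cl ^ n * (v x * t)) (tsum_congr fun z => by ring)
      _ ≤ _ := by
          rw [stepKernel_succ]
          exact stepOp_mono (hdiag n) x

end ConfinedKernel

/-! ### The Feynman–Kac data as a confined kernel -/

/-- The weight `1/V` with values in `[0,∞]`. -/
def Potential.invWeight {X : Type*} (W : Potential X) (x : X) : ℝ≥0∞ :=
  ENNReal.ofReal (W.V x)⁻¹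

theorem Potential.V_pos {X : Type*} (W : Potential X) (x : X) : 0 < W.V x := by
  obtain ⟨c, hc, h⟩ := W.lowerBounded
  exact hc.trans_le (h x)

theorem Potential.exists_invWeight_le {X : Type*} (W : Potential X) :
    ∃ c : ℝ≥0∞, c ≠ ∞ ∧ ∀ x, W.invWeight x ≤ c := by
  obtain ⟨c, hc, h⟩ := W.lowerBounded
  exact ⟨ENNReal.ofReal c⁻¹, ENNReal.ofReal_ne_top,
    fun x => ENNReal.ofReal_le_ofReal (inv_anti₀ hc (h x))⟩

/-- The potential `max V M`. -/
def Potential.truncBelow {X : Type*} (W : Potential X) (M : ℕ) : Potential X where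
  -- The level M + 1 keeps the lower bound positive when M = 0.
  V x := max (W.V x) (M + 1)
  lowerBounded := ⟨M + 1, by positivity, fun _ => le_max_right _ _⟩

namespace DualKernels

variable {X : Type*} (K : DualKernels X)

/-- The kernel `P` with values in `[0,∞]`. -/
def PE (x y : X) : ℝ≥0∞ := ENNReal.ofReal (K.P x y)

theorem P_le_one (x y : X) : K.P x y ≤ 1 :=
  ((K.P_summable x).le_tsum y fun _ _ => K.P_nonneg _ _).trans (K.P_tsum_le_one x)

theorem PE_le_one (x y : X) : K.PE x y ≤ 1 := by
  unfold PE
  simpa using K.P_le_one x y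

theorem summable_P_mul_P (x y : X) : Summable fun z => K.P x z * K.P z y :=
  (K.P_summable x).of_nonneg_of_le (fun _ => mul_nonneg (K.P_nonneg _ _) (K.P_nonneg _ _))
    fun _ => mul_le_of_le_one_right (K.P_nonneg _ _) (K.P_le_one _ _)

theorem confinedKernel {Cs : ℝ} (hA1 : K.DirectStep Cs) {W : Potential X} (hW : W.Confining) :
    ConfinedKernel W.invWeight K.PE (ENNReal.ofReal Cs) where
  v_ne_zero x := (ENNReal.ofReal_pos.2 (inv_pos.2 (W.V_pos x))).ne'
  v_ne_top _ := ENNReal.ofReal_ne_top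
  P_ne_zero x y := (ENNReal.ofReal_pos.2 (hA1.1 x y)).ne'
  P_ne_top _ _ := ENNReal.ofReal_ne_top
  C_ne_top := ENNReal.ofReal_ne_top
  direct x y := by
    unfold PE
    simp_rw [← ENNReal.ofReal_mul (K.P_nonneg _ _)]
    rw [← ENNReal.ofReal_tsum_of_nonneg
      (fun z => mul_nonneg (K.P_nonneg _ _) (K.P_nonneg _ _)) (K.summable_P_mul_P x y),
      ← ENNReal.ofReal_mul (zero_le_one.trans hA1.2.1)]
    exact ENNReal.ofReal_le_ofReal (hA1.2.2 x y)
  confining ε hε := by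
    obtain ⟨n, hn⟩ := ENNReal.exists_inv_nat_lt hε
    have hn0 : 0 < (n : ℝ) := by
      rcases Nat.eq_zero_or_pos n with rfl | h
      · simp at hn
      · exact_mod_cast h
    obtain ⟨S, hS, h⟩ := hW n
    refine ⟨hS.toFinset, fun x hx => le_trans ?_ hn.le⟩
    unfold Potential.invWeight
    rw [← ENNReal.ofReal_natCast, ← ENNReal.ofReal_inv_of_pos hn0]
    exact ENNReal.ofReal_le_ofReal (inv_anti₀ hn0 (h x fun hxS => hx (hS.mem_toFinset.2 hxS)))

/-- A function dominated by `P(·, x₀)` is in `ℓ²(μ)`. -/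
theorem tsum_mu_sq_ne_top {h : X → ℝ≥0∞} {D : ℝ≥0∞} (hD : D ≠ ∞) {x₀ : X}
    (hle : ∀ x, h x ≤ D * K.PE x x₀) : ∑' x, ENNReal.ofReal (K.μ x) * h x ^ 2 ≠ ∞ := by
  refine ne_top_of_le_ne_top (b := D ^ 2 * ENNReal.ofReal (K.μ x₀))
    (ENNReal.mul_ne_top (ENNReal.pow_ne_top hD) ENNReal.ofReal_ne_top) ?_
  calc _ ≤ ∑' x, D ^ 2 * (ENNReal.ofReal (K.μ x) * K.PE x x₀) := by
        refine ENNReal.tsum_le_tsum fun x => ?_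
        calc ENNReal.ofReal (K.μ x) * h x ^ 2
            ≤ ENNReal.ofReal (K.μ x) * (D * K.PE x x₀) ^ 2 := by gcongr; exact hle x
          _ = D ^ 2 * (ENNReal.ofReal (K.μ x) * (K.PE x x₀ * K.PE x x₀)) := by ring
          _ ≤ D ^ 2 * (ENNReal.ofReal (K.μ x) * (K.PE x x₀ * 1)) := by
              gcongr; exact K.PE_le_one _ _
          _ = _ := by rw [mul_one]
    _ ≤ _ := by
        rw [ENNReal.tsum_mul_left]
        gcongr
        exact K.tsum_ofReal_mu_P_le x₀

theorem stepOp_enorm (W : Potential X) (f : X → ℂ) (x : X) :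
    stepOp W.invWeight K.PE (fun y => ‖f y‖ₑ) x
      = W.invWeight x * ∑' y, ‖(K.P x y : ℂ) * f y‖ₑ := by
  unfold stepOp PE
  congr 1
  refine tsum_congr fun y => ?_
  rw [enorm_mul, ← ofReal_norm (K.P x y : ℂ), Complex.norm_real,
    Real.norm_of_nonneg (K.P_nonneg x y)]

theorem enorm_inv_V (W : Potential X) (x : X) : ‖((W.V x)⁻¹ : ℂ)‖ₑ = W.invWeight x := by
  rw [← ofReal_norm, norm_inv, Complex.norm_real, Real.norm_of_nonneg (W.V_pos x).le]
  rfl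

theorem coe_ext [MeasurableSpace X] {f g : K.ellTwo} (h : ∀ x, f x = g x) : f = g :=
  Lp.ext (Filter.Eventually.of_forall h)

/-! ### Compactness of 𝒰 and a positive eigenfunction at the spectral radius -/

section Operator

variable [MeasurableSpace X] [DiscreteMeasurableSpace X] [Countable X]

theorem eLpNorm_two_sq (f : X → ℂ) :
    eLpNorm f 2 K.siteMeasure ^ 2 = ∑' x, ENNReal.ofReal (K.μ x) * ‖f x‖ₑ ^ 2 := by
  rw [lintegral_enorm_sq, ← ENNReal.rpow_natCast, ← ENNReal.rpow_mul]
  norm_num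

theorem norm_fkOperator_le (W : Potential X) {c : ℝ} (hc : 0 < c) (hV : ∀ x, c ≤ W.V x) :
    ‖K.fkOperator W‖ ≤ c⁻¹ * Real.sqrt 2 := by
  refine ContinuousLinearMap.opNorm_le_bound _ (by positivity) fun f => ?_
  have h : (K.fkOperator W f : X → ℂ) = K.fkFun W f := funext (K.fkOperator_apply W f)
  rw [Lp.norm_def, Lp.norm_def, h,
    ← ENNReal.toReal_ofReal (show 0 ≤ c⁻¹ * Real.sqrt 2 by positivity), ← ENNReal.toReal_mul]
  exact ENNReal.toReal_mono
    (ENNReal.mul_ne_top ENNReal.ofReal_ne_top (Lp.memLp f).eLpNorm_ne_top)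
    (K.eLpNorm_fkFun_le W hc hV f)

theorem memLp_of_finite_support {f : X → ℂ} (S : Finset X) (h : ∀ x ∉ S, f x = 0) :
    MemLp f 2 K.siteMeasure := by
  refine ⟨(Measurable.of_discrete).aestronglyMeasurable, ?_⟩
  rw [lintegral_enorm_sq, tsum_eq_sum (s := S) fun x hx => by simp [h x hx]]
  refine ENNReal.rpow_lt_top_of_nonneg (by norm_num) (ENNReal.sum_ne_top.2 fun x _ => ?_)
  exact ENNReal.mul_ne_top ENNReal.ofReal_ne_top (ENNReal.pow_ne_top enorm_ne_top)

open Classical in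
/-- The indicator function of a point in `ℓ²(μ)`. -/
def unitVector (x : X) : K.ellTwo :=
  (K.memLp_of_finite_support (f := Pi.single x 1) {x}
    fun y hy => by simp [Finset.notMem_singleton.1 hy]).toLp _

open Classical in
theorem unitVector_apply (x y : X) : K.unitVector x y = if y = x then 1 else 0 := by
  unfold unitVector
  rw [K.coe_eq, Pi.single_apply]

theorem eq_sum_unitVector {f : K.ellTwo} {S : Finset X} (h : ∀ x ∉ S, f x = 0) :
    f = ∑ x ∈ S, f x • K.unitVector x := by
  classical
  refine K.coe_ext fun y => ?_
  have h1 := K.forall_of_ae (Lp.coeFn_finsetSum (p := 2) S fun x => f x • K.unitVector x) y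
  rw [h1, Finset.sum_apply]
  have h2 : ∀ x, (f x • K.unitVector x : K.ellTwo) y = if y = x then f x else 0 := fun x => by
    have := K.forall_of_ae (Lp.coeFn_smul (f x) (K.unitVector x)) y
    rw [this, Pi.smul_apply, unitVector_apply]
    simp
  simp_rw [h2]
  by_cases hy : y ∈ S
  · simp [hy]
  · simp [hy, h y hy]

/-- An operator whose image is supported in a fixed finite set is compact. -/
theorem isCompactOperator_of_support (T : K.ellTwo →L[ℂ] K.ellTwo) (S : Finset X)
    (h : ∀ f, ∀ x ∉ S, T f x = 0) : IsCompactOperator T := by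
  let V : Submodule ℂ K.ellTwo := Submodule.span ℂ (K.unitVector '' (S : Set X))
  have : FiniteDimensional ℂ V :=
    FiniteDimensional.span_of_finite ℂ (S.finite_toSet.image _)
  have hmem : ∀ f, T f ∈ V := fun f => by
    rw [K.eq_sum_unitVector (h f)]
    exact Submodule.sum_mem _ fun x hx => Submodule.smul_mem _ _
      (Submodule.subset_span ⟨x, hx, rfl⟩)
  have : ProperSpace V := FiniteDimensional.proper ℂ V
  have hc : IsCompactOperator (T.codRestrict V hmem) :=
    isCompactOperator_of_locallyCompactSpace_dom _
  exact hc.clm_comp V.subtypeL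

/-- Raising V to at least M + 1 gives an operator of norm at most √2/(M+1). Its difference from 𝒰
has image supported in the finite set off which V ≥ M + 1, so 𝒰 is a norm limit of finite-rank
operators. -/
theorem isCompactOperator_fkOperator {W : Potential X} (hW : W.Confining) :
    IsCompactOperator (K.fkOperator W) := by
  refine isCompactOperator_of_tendsto (l := Filter.atTop)
    (F := fun M : ℕ => K.fkOperator W - K.fkOperator (W.truncBelow M)) ?_
    (Filter.Eventually.of_forall fun M => ?_)
  · have h : Filter.Tendsto (fun M : ℕ => K.fkOperator (W.truncBelow M)) Filter.atTop
        (nhds 0) := by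
      refine squeeze_zero_norm (fun M => K.norm_fkOperator_le _ (c := M + 1) (by positivity)
        fun x => le_max_right _ _) ?_
      simpa using (tendsto_one_div_add_atTop_nhds_zero_nat (𝕜 := ℝ)).mul_const (Real.sqrt 2)
    simpa using (tendsto_const_nhds (x := K.fkOperator W)).sub h
  · obtain ⟨S, hS, h⟩ := hW (M + 1)
    refine K.isCompactOperator_of_support _ hS.toFinset fun f x hx => ?_
    have h1 := K.forall_of_ae (Lp.coeFn_sub (K.fkOperator W f)
      (K.fkOperator (W.truncBelow M) f)) x
    have h2 : (W.truncBelow M).V x = W.V x := by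
      refine max_eq_left ?_
      exact_mod_cast h x fun hxS => hx (hS.mem_toFinset.2 hxS)
    rw [sub_apply, h1, Pi.sub_apply, fkOperator_apply, fkOperator_apply, h2,
      sub_self]

theorem enorm_fkOperator_le (W : Potential X) (f : K.ellTwo) (x : X) :
    ‖K.fkOperator W f x‖ₑ ≤ stepOp W.invWeight K.PE (fun y => ‖f y‖ₑ) x := by
  rw [stepOp_enorm, fkOperator_apply, enorm_mul, enorm_inv_V]
  gcongr
  exact enorm_tsum_le_tsum_enorm

theorem stepOp_enorm_ne_top (W : Potential X) (f : K.ellTwo) (x : X) :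
    stepOp W.invWeight K.PE (fun y => ‖f y‖ₑ) x ≠ ∞ := by
  rw [stepOp_enorm]
  exact ENNReal.mul_ne_top ENNReal.ofReal_ne_top
    (tsum_enorm_ne_top_iff_summable_norm.2 (K.summable_P_mul f x).norm)

/-- On nonnegative functions there is no cancellation, so the modulus bound is an equality and can
be iterated from below. -/
theorem fkOperator_apply_of_nonneg (W : Potential X) {f : K.ellTwo}
    (hf : ∀ x, f x = ((‖f x‖ : ℝ) : ℂ)) (x : X) :
    K.fkOperator W f x = ((‖K.fkOperator W f x‖ : ℝ) : ℂ) ∧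
      ‖K.fkOperator W f x‖ₑ = stepOp W.invWeight K.PE (fun y => ‖f y‖ₑ) x := by
  have h1 : K.fkOperator W f x = (((W.V x)⁻¹ * ∑' y, K.P x y * ‖f y‖ : ℝ) : ℂ) := by
    rw [fkOperator_apply, Complex.ofReal_mul, Complex.ofReal_inv, Complex.ofReal_tsum]
    congr 1
    exact tsum_congr fun y => by rw [Complex.ofReal_mul, ← hf y]
  have hn : ∀ y, 0 ≤ K.P x y * ‖f y‖ := fun y => mul_nonneg (K.P_nonneg _ _) (norm_nonneg _)
  have h0 : 0 ≤ (W.V x)⁻¹ * ∑' y, K.P x y * ‖f y‖ :=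
    mul_nonneg (inv_nonneg.2 (W.V_pos x).le) (tsum_nonneg hn)
  have hs : Summable fun y => K.P x y * ‖f y‖ := by
    refine (K.summable_P_mul f x).norm.congr fun y => ?_
    rw [norm_mul, Complex.norm_real, Real.norm_of_nonneg (K.P_nonneg x y)]
  have h2 : ‖K.fkOperator W f x‖ = (W.V x)⁻¹ * ∑' y, K.P x y * ‖f y‖ := by
    rw [h1, Complex.norm_real, Real.norm_of_nonneg h0]
  refine ⟨by rw [h2]; exact h1, ?_⟩
  rw [← ofReal_norm, h2, ENNReal.ofReal_mul (inv_nonneg.2 (W.V_pos x).le),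
    ENNReal.ofReal_tsum_of_nonneg hn hs]
  unfold stepOp PE
  simp_rw [ENNReal.ofReal_mul (K.P_nonneg _ _), ofReal_norm]
  rfl

/-- A nonzero nonnegative `h ∈ ℓ²(μ)` with `s h ≤ 𝒰 h` forces `s` to be at most the spectral
radius of `𝒰`. -/
theorem le_spectralRadius (W : Potential X) {h : X → ℝ≥0∞} {x₀ : X} (h0 : h x₀ ≠ 0)
    (hfin : ∑' x, ENNReal.ofReal (K.μ x) * h x ^ 2 ≠ ∞) {s : ℝ≥0∞}
    (hs : ∀ x, s * h x ≤ stepOp W.invWeight K.PE h x) :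
    s ≤ spectralRadius ℂ (K.fkOperator W) := by
  have hμ : ∀ x, ENNReal.ofReal (K.μ x) ≠ 0 := fun x => (ENNReal.ofReal_pos.2 (K.μ_pos x)).ne'
  have hht : ∀ x, h x ≠ ∞ := fun x hx => by
    have := ENNReal.ne_top_of_tsum_ne_top hfin x
    rw [hx] at this
    simp [ENNReal.mul_top, hμ] at this
  have hen : ∀ x, ‖(((h x).toReal : ℝ) : ℂ)‖ₑ = h x := fun x => by
    rw [← ofReal_norm, Complex.norm_real, Real.norm_of_nonneg ENNReal.toReal_nonneg,
      ENNReal.ofReal_toReal (hht x)]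
  have hmem : MemLp (fun x => (((h x).toReal : ℝ) : ℂ)) 2 K.siteMeasure := by
    refine ⟨(Measurable.of_discrete).aestronglyMeasurable, ?_⟩
    rw [lintegral_enorm_sq]
    simp_rw [hen]
    exact ENNReal.rpow_lt_top_of_nonneg (by norm_num) hfin
  let f : K.ellTwo := hmem.toLp _
  have hf : ∀ x, f x = (((h x).toReal : ℝ) : ℂ) := K.coe_eq hmem
  have hfe : ∀ x, ‖f x‖ₑ = h x := fun x => by rw [hf, hen]
  have hiter : ∀ n : ℕ, (∀ x, (K.fkOperator W ^ n) f x = ((‖(K.fkOperator W ^ n) f x‖ : ℝ) : ℂ)) ∧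
      ∀ x, s ^ n * h x ≤ ‖(K.fkOperator W ^ n) f x‖ₑ := by
    intro n
    induction n with
    | zero =>
      refine ⟨fun x => ?_, fun x => ?_⟩
      · simp only [pow_zero, one_apply_eq_self]
        rw [hf, Complex.norm_real, Real.norm_of_nonneg ENNReal.toReal_nonneg]
      · simp [hfe]
    | succ n ih =>
      have hstep : (K.fkOperator W ^ (n + 1)) f = K.fkOperator W ((K.fkOperator W ^ n) f) := by
        rw [pow_succ']; rfl
      rw [hstep]
      refine ⟨fun x => (K.fkOperator_apply_of_nonneg W ih.1 x).1, fun x => ?_⟩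
      rw [(K.fkOperator_apply_of_nonneg W ih.1 x).2]
      calc s ^ (n + 1) * h x = s ^ n * (s * h x) := by ring
        _ ≤ s ^ n * stepOp W.invWeight K.PE h x := mul_le_mul_right (hs x) _
        _ = stepOp W.invWeight K.PE (fun y => s ^ n * h y) x := by rw [stepOp_const_mul]
        _ ≤ _ := stepOp_mono ih.2 x
  set N := ∑' x, ENNReal.ofReal (K.μ x) * h x ^ 2 with hN
  have hN0 : N ≠ 0 := fun hz => by
    rw [hN, ENNReal.tsum_eq_zero] at hz
    exact mul_ne_zero (hμ x₀) (pow_ne_zero 2 h0) (hz x₀)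
  have hfN : ‖f‖ₑ ^ 2 = N := by
    rw [Lp.enorm_def, eLpNorm_two_sq]
    simp_rw [hfe, hN]
  have hpow : ∀ n : ℕ, s ^ n ≤ ‖K.fkOperator W ^ n‖ₑ := fun n => by
    have h1 : (s ^ n) ^ 2 * N ≤ ‖K.fkOperator W ^ n‖ₑ ^ 2 * N := by
      calc (s ^ n) ^ 2 * N = ∑' x, ENNReal.ofReal (K.μ x) * (s ^ n * h x) ^ 2 := by
            rw [hN, ← ENNReal.tsum_mul_left]
            exact tsum_congr fun x => by ring
        _ ≤ ‖(K.fkOperator W ^ n) f‖ₑ ^ 2 := by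
            rw [Lp.enorm_def, eLpNorm_two_sq]
            gcongr with x
            exact (hiter n).2 x
        _ ≤ (‖K.fkOperator W ^ n‖ₑ * ‖f‖ₑ) ^ 2 := by
            gcongr
            exact ContinuousLinearMap.le_opENorm _ _
        _ = _ := by rw [mul_pow, hfN]
    have h2 := (ENNReal.mul_le_mul_iff_left hN0 hfin).1 h1
    exact (ENNReal.pow_le_pow_left_iff two_ne_zero).1 h2
  -- Gelfand's formula turns s^n ≤ ‖𝒰^n‖ into the claim.
  refine ge_of_tendsto (spectrum.pow_nnnorm_pow_one_div_tendsto_nhds_spectralRadius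
    (K.fkOperator W)) ?_
  filter_upwards [Filter.eventually_gt_atTop 0] with n hn
  calc s = (s ^ n) ^ (1 / n : ℝ) := by
        rw [one_div, ENNReal.pow_rpow_inv_natCast hn.ne']
    _ ≤ _ := ENNReal.rpow_le_rpow (hpow n) (by positivity)

theorem spectralRadius_ne_top (W : Potential X) : spectralRadius ℂ (K.fkOperator W) ≠ ∞ := by
  have := spectrum.spectralRadius_le_pow_nnnorm_pow_one_div ℂ (K.fkOperator W) 0
  refine ne_top_of_le_ne_top ?_ this
  simp [ENNReal.mul_eq_top]

/-- The point mass at x₀ is a subsolution with factor v(x₀)P(x₀,x₀) > 0. -/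
theorem spectralRadius_ne_zero {W : Potential X} {Cs : ℝ} (hA1 : K.DirectStep Cs) (x₀ : X) :
    spectralRadius ℂ (K.fkOperator W) ≠ 0 := by
  classical
  have hv : W.invWeight x₀ ≠ 0 := (ENNReal.ofReal_pos.2 (inv_pos.2 (W.V_pos x₀))).ne'
  have hp : K.PE x₀ x₀ ≠ 0 := (ENNReal.ofReal_pos.2 (hA1.1 x₀ x₀)).ne'
  have h := K.le_spectralRadius W (h := Pi.single x₀ 1) (x₀ := x₀) (by simp) (by
      rw [tsum_eq_single x₀ fun y hy => by simp [hy]]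
      simp) (s := W.invWeight x₀ * K.PE x₀ x₀) (fun x => by
        by_cases hx : x = x₀
        · subst hx
          simpa using le_stepOp (v := W.invWeight) (P := K.PE) (Pi.single x 1) x x
        · simp [hx])
  exact fun hz => mul_ne_zero hv hp (le_zero_iff.1 (h.trans_eq hz))

/-- Existence of a strictly positive eigenfunction for the spectral radius. -/
theorem exists_pos_eigen {W : Potential X} {Cs : ℝ} (hA1 : K.DirectStep Cs) (hW : W.Confining)
    (x₀ : X) :
    ∃ g : X → ℝ≥0∞, (∀ x, g x ≠ 0) ∧ (∀ x, g x ≠ ∞) ∧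
      ∀ x, stepOp W.invWeight K.PE g x = spectralRadius ℂ (K.fkOperator W) * g x := by
  have H := K.confinedKernel hA1 hW
  set r := spectralRadius ℂ (K.fkOperator W) with hr
  have hr0 : r ≠ 0 := K.spectralRadius_ne_zero hA1 x₀
  have hrt : r ≠ ∞ := K.spectralRadius_ne_top W
  have hne : (spectrum ℂ (K.fkOperator W)).Nonempty := by
    by_contra hemp
    rw [Set.not_nonempty_iff_eq_empty] at hemp
    exact hr0 (by rw [hr, spectralRadius, hemp]; simp)
  obtain ⟨l, hl, hlr⟩ := spectrum.exists_nnnorm_eq_spectralRadius_of_nonempty hne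
  have hl0 : l ≠ 0 := by
    rintro rfl
    exact hr0 (by rw [hr, ← hlr]; simp)
  -- A nonzero spectral value of a compact operator is an eigenvalue; l is one of maximal modulus.
  obtain ⟨f, hf⟩ := (((K.isCompactOperator_fkOperator hW).hasEigenvalue_iff_mem_spectrum
    hl0).2 hl).exists_hasEigenvector
  have hfl : K.fkOperator W f = l • f := hf.apply_eq_smul
  obtain ⟨x₁, hx₁⟩ : ∃ x, f x ≠ 0 := by
    by_contra! hz
    refine hf.2 (K.coe_ext fun x => ?_)
    rw [hz x, K.forall_of_ae (Lp.coeFn_zero ℂ 2 K.siteMeasure) x]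
    rfl
  set g : X → ℝ≥0∞ := fun x => ‖f x‖ₑ with hg
  have hsub : ∀ x, r * g x ≤ stepOp W.invWeight K.PE g x := fun x => by
    refine le_trans (le_of_eq ?_) (K.enorm_fkOperator_le W f x)
    rw [hfl, K.forall_of_ae (Lp.coeFn_smul l f) x, Pi.smul_apply, smul_eq_mul, enorm_mul,
      hr, ← hlr]
    rfl
  have hfin : ∀ x, stepOp W.invWeight K.PE g x ≠ ∞ := K.stepOp_enorm_ne_top W f
  have hpos : ∀ x, stepOp W.invWeight K.PE g x ≠ 0 := fun x h => by
    have := le_stepOp (v := W.invWeight) (P := K.PE) g x x₁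
    rw [h, le_zero_iff] at this
    exact mul_ne_zero (mul_ne_zero (H.v_ne_zero x) (H.P_ne_zero x x₁))
      (by simpa [hg] using hx₁) this
  -- A strict inequality at x₂ would make Tg an ℓ² subsolution with factor r + δ, since Tg ≥ rg +
  -- (surplus)·1_{x₂}.
  have heq : ∀ x, stepOp W.invWeight K.PE g x = r * g x := by
    by_contra! hcon
    obtain ⟨x₂, hx₂⟩ := hcon
    classical
    set h := stepOp W.invWeight K.PE g with hh
    have hδ : h x₂ - r * g x₂ ≠ 0 := (tsub_pos_of_lt (lt_of_le_of_ne (hsub x₂) hx₂.symm)).ne'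
    obtain ⟨δ, hδ0, hδ'⟩ := H.exists_le_mul_of_subsolution hr0 hrt hsub hfin x₂ hδ
    obtain ⟨D, hD, hD'⟩ := H.exists_subsolution_le hr0 hrt hsub hfin x₂
    obtain ⟨c, hc, hc'⟩ := W.exists_invWeight_le
    have hsum : ∑' x, ENNReal.ofReal (K.μ x) * h x ^ 2 ≠ ∞ :=
      K.tsum_mu_sq_ne_top (ENNReal.mul_ne_top hD hc) (x₀ := x₂) fun x => (hD' x).trans (by
        rw [mul_assoc]
        gcongr
        exact hc' x)
    have hstep : ∀ x, (r + δ) * h x ≤ stepOp W.invWeight K.PE h x := fun x => by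
      calc (r + δ) * h x = r * h x + δ * h x := add_mul _ _ _
        _ ≤ r * h x + (h x₂ - r * g x₂) * (W.invWeight x * K.PE x x₂) :=
          add_le_add_right (hδ' x) _
        _ ≤ stepOp W.invWeight K.PE (fun y => r * g y) x
            + stepOp W.invWeight K.PE (Pi.single x₂ (h x₂ - r * g x₂)) x := by
          rw [stepOp_const_mul]
          refine add_le_add_right ?_ _
          have := le_stepOp (v := W.invWeight) (P := K.PE)
            (Pi.single x₂ (h x₂ - r * g x₂)) x x₂
          rwa [Pi.single_eq_same, mul_comm] at this
        _ = stepOp W.invWeight K.PE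
              (fun y => r * g y + (Pi.single x₂ (h x₂ - r * g x₂) : X → ℝ≥0∞) y) x := by
          rw [stepOp_add]
        _ ≤ _ := by
          refine stepOp_mono (fun y => ?_) x
          by_cases hy : y = x₂
          · subst hy
            rw [Pi.single_eq_same, add_tsub_cancel_of_le (hsub y)]
          · rw [Pi.single_eq_of_ne hy, add_zero]
            exact hsub y
    have hle := K.le_spectralRadius W (hpos x₂) hsum hstep
    exact absurd hle (not_le.2 (ENNReal.lt_add_right hrt hδ0))
  refine ⟨g, fun x hx => hpos x ?_, fun x => enorm_ne_top, heq⟩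
  rw [heq, hx, mul_zero]

end Operator

end DualKernels

/-! ### Uniqueness of eigenfunctions up to scaling -/

theorem hasSum_iff_tsum_ofReal {ι : Type*} {f : ι → ℝ} {a : ℝ} (hf : ∀ i, 0 ≤ f i)
    (ha : 0 ≤ a) : HasSum f a ↔ ∑' i, ENNReal.ofReal (f i) = ENNReal.ofReal a := by
  constructor
  · intro h
    rw [← ENNReal.ofReal_tsum_of_nonneg hf h.summable, h.tsum_eq]
  · intro h
    have hs : Summable f := by
      have := ENNReal.summable_toReal (h.trans_ne ENNReal.ofReal_ne_top)
      exact this.congr fun i => ENNReal.toReal_ofReal (hf i)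
    rw [← ENNReal.ofReal_tsum_of_nonneg hf hs,
      ENNReal.ofReal_eq_ofReal_iff (tsum_nonneg hf) ha] at h
    exact h ▸ hs.hasSum

/-- Take the largest c with ck ≤ g. If g − ck were nonzero at some point, this eigenfunction would
dominate some δk with δ > 0, and c could be increased. -/
theorem ConfinedKernel.eigen_unique {X : Type*} {v : X → ℝ≥0∞} {P : X → X → ℝ≥0∞}
    {C Λ : ℝ≥0∞} (H : ConfinedKernel v P C) [Nonempty X] (h0 : Λ ≠ 0) (ht : Λ ≠ ∞)
    {g k : X → ℝ≥0∞} (hgt : ∀ x, g x ≠ ∞) (hk0 : ∀ x, k x ≠ 0)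
    (hkt : ∀ x, k x ≠ ∞) (hg : ∀ x, stepOp v P g x = Λ * g x)
    (hk : ∀ x, stepOp v P k x = Λ * k x) : ∃ c : ℝ≥0∞, ∀ x, g x = c * k x := by
  set c : ℝ≥0∞ := ⨅ x, g x / k x with hc
  have hct : c ≠ ∞ := ne_top_of_le_ne_top
    (ENNReal.div_ne_top (hgt (Classical.arbitrary X)) (hk0 _)) (iInf_le _ (Classical.arbitrary X))
  have hle : ∀ x, c * k x ≤ g x := fun x => by
    rw [← ENNReal.le_div_iff_mul_le (Or.inl (hk0 x)) (Or.inl (hkt x))]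
    exact iInf_le _ x
  refine ⟨c, ?_⟩
  by_contra! hcon
  obtain ⟨x₁, hx₁⟩ := hcon
  set h : X → ℝ≥0∞ := fun x => g x - c * k x with hh
  have hx₁' : h x₁ ≠ 0 := (tsub_pos_of_lt (lt_of_le_of_ne (hle x₁) hx₁.symm)).ne'
  have hadd : (fun x => c * k x + h x) = g := funext fun x => add_tsub_cancel_of_le (hle x)
  have hckt : ∀ x, c * k x ≠ ∞ := fun x => ENNReal.mul_ne_top hct (hkt x)
  have hstep : ∀ x, stepOp v P h x = Λ * h x := fun x => by
    have h1 : Λ * (c * k x) + stepOp v P h x = Λ * (c * k x) + Λ * h x := by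
      rw [← mul_add, congrFun hadd x, ← hg x]
      conv_rhs => rw [← hadd, stepOp_add, stepOp_const_mul]
      simp only [hk]
      rw [mul_left_comm]
    exact (ENNReal.add_right_inj (ENNReal.mul_ne_top ht (hckt x))).1 h1
  obtain ⟨δ, hδ0, hδ⟩ := H.exists_le_mul_of_subsolution h0 ht (fun x => (hk x).ge)
    (fun x => by rw [hk]; exact ENNReal.mul_ne_top ht (hkt x)) x₁ hx₁'
  have hδk : ∀ x, δ * k x ≤ h x := fun x => by
    refine (ENNReal.mul_le_mul_iff_right h0 ht).1 ?_
    rw [← hstep, mul_left_comm, ← hk]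
    refine (hδ x).trans ?_
    rw [mul_comm]
    exact le_stepOp h x x₁
  have hcδ : c + δ ≤ c := le_iInf fun x => by
    rw [ENNReal.le_div_iff_mul_le (Or.inl (hk0 x)) (Or.inl (hkt x)), add_mul,
      ← congrFun hadd x]
    exact add_le_add_right (hδk x) _
  exact absurd hcδ (not_le.2 (ENNReal.lt_add_right hct hδ0))

/-! ### Duality and the two normalized ground states -/

namespace DualKernels

variable {X : Type*} (K : DualKernels X)

/-- The dual pair of kernels with the roles of `P` and `Pd` exchanged. -/
def swap : DualKernels X where
  P := K.Pd
  Pd := K.P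
  μ := K.μ
  P_nonneg := K.Pd_nonneg
  P_summable := K.Pd_summable
  P_tsum_le_one := K.Pd_tsum_le_one
  Pd_nonneg := K.P_nonneg
  Pd_summable := K.P_summable
  Pd_tsum_le_one := K.P_tsum_le_one
  μ_pos := K.μ_pos
  duality x y := (K.duality y x).symm

theorem Pd_eq (x y : X) : K.Pd x y = K.μ y / K.μ x * K.P y x := by
  rw [div_mul_eq_mul_div, K.duality, mul_div_cancel_left₀ _ (K.μ_pos x).ne']

/-- P̂ is the transpose of P conjugated by μ; the weight of the intermediate site cancels in
two-step sums. -/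
theorem swap_directStep {Cs : ℝ} (h : K.DirectStep Cs) : K.swap.DirectStep Cs := by
  refine ⟨fun x y => ?_, h.2.1, fun x y => ?_⟩
  · change 0 < K.Pd x y
    rw [Pd_eq]
    exact mul_pos (div_pos (K.μ_pos y) (K.μ_pos x)) (h.1 y x)
  · have h1 : K.swap.P₂ x y = K.μ y / K.μ x * K.P₂ y x := by
      unfold P₂
      rw [← tsum_mul_left]
      refine tsum_congr fun z => ?_
      change K.Pd x z * K.Pd z y = _
      rw [Pd_eq, Pd_eq]
      have := (K.μ_pos z).ne'
      field_simp
    rw [h1]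
    change _ ≤ Cs * K.Pd x y
    rw [Pd_eq, mul_left_comm]
    exact mul_le_mul_of_nonneg_left (h.2.2 y x) (div_pos (K.μ_pos y) (K.μ_pos x)).le

theorem mu_mul_PE (x y : X) :
    ENNReal.ofReal (K.μ x) * K.PE x y = ENNReal.ofReal (K.μ y) * K.swap.PE y x := by
  unfold PE
  rw [← ENNReal.ofReal_mul (K.μ_pos x).le, ← ENNReal.ofReal_mul (K.μ_pos y).le, K.duality]
  rfl

/-- By duality, μ times an eigenfunction of 𝒰̂ is a left eigenmeasure of v·P. -/
theorem left_of_swap_eigen {W : Potential X} {Λ : ℝ≥0∞} {F : X → ℝ≥0∞}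
    (hF : ∀ x, ∑' y, K.swap.PE x y * (W.invWeight y * F y) = Λ * F x) (y : X) :
    ∑' x, (ENNReal.ofReal (K.μ x) * F x) * (W.invWeight x * K.PE x y)
      = Λ * (ENNReal.ofReal (K.μ y) * F y) := by
  rw [mul_left_comm, ← hF, ← ENNReal.tsum_mul_left]
  refine tsum_congr fun x => ?_
  calc _ = ENNReal.ofReal (K.μ x) * K.PE x y * (W.invWeight x * F x) := by ring
    _ = _ := by rw [mu_mul_PE, mul_assoc]

theorem invWeight_mul_ofReal_V (W : Potential X) (x : X) :
    W.invWeight x * ENNReal.ofReal (W.V x) = 1 := by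
  unfold Potential.invWeight
  rw [← ENNReal.ofReal_mul (inv_nonneg.2 (W.V_pos x).le), inv_mul_cancel₀ (W.V_pos x).ne',
    ENNReal.ofReal_one]

theorem hasSum_sq_iff {φ : X → ℝ} (hφ : ∀ x, 0 < φ x) :
    HasSum (fun x => φ x ^ 2 * K.μ x) 1
      ↔ ∑' x, ENNReal.ofReal (K.μ x) * ENNReal.ofReal (φ x) ^ 2 = 1 := by
  rw [hasSum_iff_tsum_ofReal (fun x => mul_nonneg (sq_nonneg _) (K.μ_pos x).le) zero_le_one,
    ENNReal.ofReal_one]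
  have h : ∀ x, ENNReal.ofReal (φ x ^ 2 * K.μ x)
      = ENNReal.ofReal (K.μ x) * ENNReal.ofReal (φ x) ^ 2 := fun x => by
    rw [ENNReal.ofReal_mul (sq_nonneg _), ENNReal.ofReal_pow (hφ x).le, mul_comm]
  simp_rw [h]

theorem exists_normalization {F : X → ℝ≥0∞} {x₀ : X} (h0 : F x₀ ≠ 0)
    (hfin : ∑' x, ENNReal.ofReal (K.μ x) * F x ^ 2 ≠ ∞) :
    ∃ s : ℝ≥0∞, s ≠ 0 ∧ s ≠ ∞ ∧ ∑' x, ENNReal.ofReal (K.μ x) * (s * F x) ^ 2 = 1 := by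
  set N := ∑' x, ENNReal.ofReal (K.μ x) * F x ^ 2 with hN
  have hN0 : N ≠ 0 := fun hz => by
    rw [hN, ENNReal.tsum_eq_zero] at hz
    exact mul_ne_zero (ENNReal.ofReal_pos.2 (K.μ_pos x₀)).ne' (pow_ne_zero 2 h0) (hz x₀)
  refine ⟨(N ^ (1 / 2 : ℝ))⁻¹, ENNReal.inv_ne_zero.2
    (ENNReal.rpow_ne_top_of_nonneg (by norm_num) hfin),
    ENNReal.inv_ne_top.2 fun h => hN0 ?_, ?_⟩
  · rw [ENNReal.rpow_eq_zero_iff] at h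
    rcases h with h | h
    · exact h.1
    · exact absurd h.2 (by norm_num)
  · simp_rw [mul_pow, mul_left_comm (ENNReal.ofReal _)]
    rw [ENNReal.tsum_mul_left, ← hN, ← ENNReal.inv_pow, ← ENNReal.rpow_natCast,
      ← ENNReal.rpow_mul]
    norm_num
    exact ENNReal.inv_mul_cancel hN0 hfin

theorem eq_of_eq_mul_of_normalized {φ ψ : X → ℝ} (hφ : ∀ x, 0 < φ x) (hψ : ∀ x, 0 < ψ x)
    (h1 : ∑' x, ENNReal.ofReal (K.μ x) * ENNReal.ofReal (φ x) ^ 2 = 1)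
    (h2 : ∑' x, ENNReal.ofReal (K.μ x) * ENNReal.ofReal (ψ x) ^ 2 = 1) {c : ℝ≥0∞}
    (h : ∀ x, ENNReal.ofReal (φ x) = c * ENNReal.ofReal (ψ x)) : φ = ψ := by
  have hc : c ^ 2 = 1 := by
    simp_rw [h, mul_pow, mul_left_comm (ENNReal.ofReal _)] at h1
    rwa [ENNReal.tsum_mul_left, h2, mul_one] at h1
  have hc1 : c = 1 := le_antisymm
    ((ENNReal.pow_le_pow_left_iff two_ne_zero).1 (by rw [hc, one_pow]))
    ((ENNReal.pow_le_pow_left_iff two_ne_zero).1 (by rw [hc, one_pow]))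
  funext x
  have := h x
  rwa [hc1, one_mul, ENNReal.ofReal_eq_ofReal_iff (hφ x).le (hψ x).le] at this

section GroundState

variable [Countable X]

theorem lam0_nonneg (W : Potential X) : 0 ≤ K.lam0 W := ENNReal.toReal_nonneg

theorem exists_pos_eigen_lam0 {W : Potential X} {Cs : ℝ} (hA1 : K.DirectStep Cs)
    (hW : W.Confining) (x₀ : X) :
    0 < K.lam0 W ∧ ∃ g : X → ℝ≥0∞, (∀ x, g x ≠ 0) ∧ (∀ x, g x ≠ ∞) ∧
      ∀ x, stepOp W.invWeight K.PE g x = ENNReal.ofReal (K.lam0 W) * g x := by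
  let _ : MeasurableSpace X := ⊤
  have : DiscreteMeasurableSpace X := ⟨fun _ => trivial⟩
  refine ⟨ENNReal.toReal_pos (K.spectralRadius_ne_zero hA1 x₀) (K.spectralRadius_ne_top W), ?_⟩
  have h : ENNReal.ofReal (K.lam0 W) = spectralRadius ℂ (K.fkOperator W) :=
    ENNReal.ofReal_toReal (K.spectralRadius_ne_top W)
  rw [h]
  exact K.exists_pos_eigen hA1 hW x₀

theorem exists_eigen_le_PE {W : Potential X} {Cs : ℝ} (hA1 : K.DirectStep Cs)
    (hW : W.Confining) (x₀ : X) {g : X → ℝ≥0∞} (hgt : ∀ x, g x ≠ ∞)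
    (hg : ∀ x, stepOp W.invWeight K.PE g x = ENNReal.ofReal (K.lam0 W) * g x) :
    ∃ D : ℝ≥0∞, D ≠ ∞ ∧ ∀ x, g x ≤ D * (W.invWeight x * K.PE x x₀) :=
  (K.confinedKernel hA1 hW).exists_eigen_le
    (ENNReal.ofReal_pos.2 (K.exists_pos_eigen_lam0 hA1 hW x₀).1).ne' ENNReal.ofReal_ne_top hg hgt x₀

/-- The dual eigenfunction `V g`, where `g` is an eigenfunction of `f ↦ V⁻¹ Pd f`. -/
theorem exists_swap_eigen {W : Potential X} {Cs : ℝ} (hA1 : K.DirectStep Cs)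
    (hW : W.Confining) (x₀ : X) :
    ∃ F : X → ℝ≥0∞, (∀ x, F x ≠ 0) ∧ (∀ x, F x ≠ ∞) ∧
      (∃ D : ℝ≥0∞, D ≠ ∞ ∧ ∀ x, F x ≤ D * K.swap.PE x x₀) ∧
      ∀ x, ∑' y, K.swap.PE x y * (W.invWeight y * F y)
        = ENNReal.ofReal (K.swap.lam0 W) * F x := by
  obtain ⟨-, g, hg0, hgt, hg⟩ := K.swap.exists_pos_eigen_lam0 (K.swap_directStep hA1) hW x₀
  obtain ⟨D, hD, hgD⟩ := K.swap.exists_eigen_le_PE (K.swap_directStep hA1) hW x₀ hgt hg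
  have hvF : ∀ x, W.invWeight x * (ENNReal.ofReal (W.V x) * g x) = g x := fun x => by
    rw [← mul_assoc, invWeight_mul_ofReal_V, one_mul]
  refine ⟨fun x => ENNReal.ofReal (W.V x) * g x,
    fun x => mul_ne_zero (ENNReal.ofReal_pos.2 (W.V_pos x)).ne' (hg0 x),
    fun x => ENNReal.mul_ne_top ENNReal.ofReal_ne_top (hgt x), ⟨D, hD, fun x => ?_⟩, fun x => ?_⟩
  · calc ENNReal.ofReal (W.V x) * g x
        ≤ ENNReal.ofReal (W.V x) * (D * (W.invWeight x * K.swap.PE x x₀)) :=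
          mul_le_mul_right (hgD x) _
      _ = W.invWeight x * ENNReal.ofReal (W.V x) * (D * K.swap.PE x x₀) := by ring
      _ = _ := by rw [invWeight_mul_ofReal_V, one_mul]
  · simp_rw [hvF]
    rw [mul_left_comm, ← hg x, stepOp, ← mul_assoc, mul_comm (ENNReal.ofReal _),
      invWeight_mul_ofReal_V, one_mul]

/-- The dual kernels have the same spectral radius. -/
theorem swap_lam0 {W : Potential X} {Cs : ℝ} (hA1 : K.DirectStep Cs) (hW : W.Confining)
    (x₀ : X) : K.swap.lam0 W = K.lam0 W := by
  obtain ⟨-, g, hg0, hgt, hg⟩ := K.exists_pos_eigen_lam0 hA1 hW x₀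
  obtain ⟨F, hF0, hFt, ⟨D, hD, hFD⟩, hF⟩ := K.exists_swap_eigen hA1 hW x₀
  obtain ⟨D', hD', hgD⟩ := K.exists_eigen_le_PE hA1 hW x₀ hgt hg
  obtain ⟨c, hc, hc'⟩ := W.exists_invWeight_le
  -- The pairing ∑ μ·F·Tg is evaluated through F and through g; as s = ∑ μFg is nonzero and finite,
  -- the eigenvalues agree.
  have h := tsum_left_eigen_mul_stepOp (K.left_of_swap_eigen hF) g
  set s := ∑' x, ENNReal.ofReal (K.μ x) * F x * g x with hs
  have h2 : ∑' x, ENNReal.ofReal (K.μ x) * F x * stepOp W.invWeight K.PE g x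
      = ENNReal.ofReal (K.lam0 W) * s := by
    rw [hs, ← ENNReal.tsum_mul_left]
    exact tsum_congr fun x => by rw [hg x]; ring
  have hs0 : s ≠ 0 := fun hz => by
    rw [hs, ENNReal.tsum_eq_zero] at hz
    exact mul_ne_zero (mul_ne_zero (ENNReal.ofReal_pos.2 (K.μ_pos x₀)).ne' (hF0 x₀)) (hg0 x₀)
      (hz x₀)
  have hst : s ≠ ∞ := by
    refine ne_top_of_le_ne_top (b := D * D' * c * ENNReal.ofReal (K.μ x₀))
      (ENNReal.mul_ne_top (ENNReal.mul_ne_top (ENNReal.mul_ne_top hD hD') hc)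
        ENNReal.ofReal_ne_top) ?_
    calc s ≤ ∑' x, D * D' * c * (ENNReal.ofReal (K.μ x) * K.PE x x₀) := by
          refine ENNReal.tsum_le_tsum fun x => ?_
          calc ENNReal.ofReal (K.μ x) * F x * g x
              ≤ ENNReal.ofReal (K.μ x) * (D * K.swap.PE x x₀)
                  * (D' * (W.invWeight x * K.PE x x₀)) := by gcongr; exacts [hFD x, hgD x]
            _ ≤ ENNReal.ofReal (K.μ x) * (D * 1) * (D' * (c * K.PE x x₀)) := by
                gcongr
                exacts [K.swap.PE_le_one x x₀, hc' x]
            _ = _ := by ring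
      _ ≤ _ := by
          rw [ENNReal.tsum_mul_left]
          gcongr
          exact K.tsum_ofReal_mu_P_le x₀
  rw [h2] at h
  have h3 := (ENNReal.mul_left_inj hs0 hst).1 h
  exact ((ENNReal.ofReal_eq_ofReal_iff (K.lam0_nonneg W) (K.swap.lam0_nonneg W)).1 h3).symm

theorem isGroundState_iff {W : Potential X} {φ : X → ℝ} :
    K.IsGroundState W φ ↔ (∀ x, 0 < φ x) ∧
      ∑' x, ENNReal.ofReal (K.μ x) * ENNReal.ofReal (φ x) ^ 2 = 1 ∧
      ∀ x, stepOp W.invWeight K.PE (fun y => ENNReal.ofReal (φ y)) x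
        = ENNReal.ofReal (K.lam0 W) * ENNReal.ofReal (φ x) := by
  refine and_congr_right fun hφ => and_congr (K.hasSum_sq_iff hφ) (forall_congr' fun x => ?_)
  have hV := inv_nonneg.2 (W.V_pos x).le
  rw [hasSum_iff_tsum_ofReal
    (fun y => mul_nonneg hV (mul_nonneg (K.P_nonneg x y) (hφ y).le))
    (mul_nonneg (K.lam0_nonneg W) (hφ x).le), ENNReal.ofReal_mul (K.lam0_nonneg W)]
  simp_rw [ENNReal.ofReal_mul hV, ENNReal.ofReal_mul (K.P_nonneg _ _), ENNReal.tsum_mul_left]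
  rfl

theorem isDualGroundState_iff {W : Potential X} {φ : X → ℝ} :
    K.IsDualGroundState W φ ↔ (∀ x, 0 < φ x) ∧
      ∑' x, ENNReal.ofReal (K.μ x) * ENNReal.ofReal (φ x) ^ 2 = 1 ∧
      ∀ x, ∑' y, K.swap.PE x y * (W.invWeight y * ENNReal.ofReal (φ y))
        = ENNReal.ofReal (K.lam0 W) * ENNReal.ofReal (φ x) := by
  refine and_congr_right fun hφ => and_congr (K.hasSum_sq_iff hφ) (forall_congr' fun x => ?_)
  have hV : ∀ y, 0 ≤ (W.V y)⁻¹ := fun y => inv_nonneg.2 (W.V_pos y).le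
  rw [hasSum_iff_tsum_ofReal
    (fun y => mul_nonneg (mul_nonneg (K.Pd_nonneg x y) (hV y)) (hφ y).le)
    (mul_nonneg (K.lam0_nonneg W) (hφ x).le), ENNReal.ofReal_mul (K.lam0_nonneg W)]
  simp_rw [ENNReal.ofReal_mul (mul_nonneg (K.Pd_nonneg _ _) (hV _)),
    ENNReal.ofReal_mul (K.Pd_nonneg _ _), mul_assoc]
  rfl

theorem existsUnique_groundState [Nonempty X] {W : Potential X} {Cs : ℝ}
    (hA1 : K.DirectStep Cs) (hW : W.Confining) : ∃! φ : X → ℝ, K.IsGroundState W φ := by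
  let x₀ : X := Classical.arbitrary X
  obtain ⟨hlam, g, hg0, hgt, hg⟩ := K.exists_pos_eigen_lam0 hA1 hW x₀
  obtain ⟨D, hD, hgD⟩ := K.exists_eigen_le_PE hA1 hW x₀ hgt hg
  obtain ⟨c, hc, hc'⟩ := W.exists_invWeight_le
  obtain ⟨s, hs0, hst, hs⟩ := K.exists_normalization (hg0 x₀)
    (K.tsum_mu_sq_ne_top (ENNReal.mul_ne_top hD hc) (x₀ := x₀) fun x => (hgD x).trans (by
      rw [mul_assoc]; gcongr; exact hc' x))
  have hof : ∀ x, ENNReal.ofReal (s * g x).toReal = s * g x := fun x =>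
    ENNReal.ofReal_toReal (ENNReal.mul_ne_top hst (hgt x))
  refine existsUnique_of_exists_of_unique ⟨fun x => (s * g x).toReal,
    K.isGroundState_iff.2 ⟨fun x => ENNReal.toReal_pos
    (mul_ne_zero hs0 (hg0 x)) (ENNReal.mul_ne_top hst (hgt x)), ?_, fun x => ?_⟩⟩ ?_
  · simp_rw [hof, hs]
  · simp_rw [hof, stepOp_const_mul, hg, mul_left_comm]
  · intro φ ψ hφ hψ
    rw [isGroundState_iff] at hφ hψ
    obtain ⟨c, hc⟩ := (K.confinedKernel hA1 hW).eigen_unique (ENNReal.ofReal_pos.2 hlam).ne'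
      ENNReal.ofReal_ne_top (fun _ => ENNReal.ofReal_ne_top)
      (fun x => (ENNReal.ofReal_pos.2 (hψ.1 x)).ne') (fun _ => ENNReal.ofReal_ne_top) hφ.2.2 hψ.2.2
    exact K.eq_of_eq_mul_of_normalized hφ.1 hψ.1 hφ.2.1 hψ.2.1 hc

theorem existsUnique_dualGroundState [Nonempty X] {W : Potential X} {Cs : ℝ}
    (hA1 : K.DirectStep Cs) (hW : W.Confining) : ∃! φ : X → ℝ, K.IsDualGroundState W φ := by
  let x₀ : X := Classical.arbitrary X
  obtain ⟨hlam, -⟩ := K.exists_pos_eigen_lam0 hA1 hW x₀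
  obtain ⟨F, hF0, hFt, ⟨D, hD, hFD⟩, hF⟩ := K.exists_swap_eigen hA1 hW x₀
  rw [K.swap_lam0 hA1 hW x₀] at hF
  have hfin : ∑' x, ENNReal.ofReal (K.μ x) * F x ^ 2 ≠ ∞ := K.swap.tsum_mu_sq_ne_top hD hFD
  obtain ⟨s, hs0, hst, hs⟩ := K.exists_normalization (hF0 x₀) hfin
  have hof : ∀ x, ENNReal.ofReal (s * F x).toReal = s * F x := fun x =>
    ENNReal.ofReal_toReal (ENNReal.mul_ne_top hst (hFt x))
  refine existsUnique_of_exists_of_unique ⟨fun x => (s * F x).toReal,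
    K.isDualGroundState_iff.2 ⟨fun x => ENNReal.toReal_pos
    (mul_ne_zero hs0 (hF0 x)) (ENNReal.mul_ne_top hst (hFt x)), ?_, fun x => ?_⟩⟩ ?_
  · simp_rw [hof, hs]
  · simp_rw [hof, mul_left_comm _ s, ENNReal.tsum_mul_left, hF]
  · intro φ ψ hφ hψ
    rw [isDualGroundState_iff] at hφ hψ
    -- Multiplication by 1/V carries eigenfunctions of P̂V⁻¹ to those of V⁻¹P̂, to which the
    -- uniqueness result applies.
    have hstep : ∀ χ : X → ℝ, (∀ x, ∑' y, K.swap.PE x y * (W.invWeight y * ENNReal.ofReal (χ y))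
        = ENNReal.ofReal (K.lam0 W) * ENNReal.ofReal (χ x)) → ∀ x,
        stepOp W.invWeight K.swap.PE (fun y => W.invWeight y * ENNReal.ofReal (χ y)) x
          = ENNReal.ofReal (K.lam0 W) * (W.invWeight x * ENNReal.ofReal (χ x)) := by
      intro χ hχ x
      unfold stepOp
      rw [hχ, mul_left_comm]
    have H := K.swap.confinedKernel (K.swap_directStep hA1) hW
    obtain ⟨c, hc⟩ := H.eigen_unique
      (ENNReal.ofReal_pos.2 hlam).ne' ENNReal.ofReal_ne_top
      (fun x => ENNReal.mul_ne_top (H.v_ne_top x) ENNReal.ofReal_ne_top)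
      (fun x => mul_ne_zero (H.v_ne_zero x) (ENNReal.ofReal_pos.2 (hψ.1 x)).ne')
      (fun x => ENNReal.mul_ne_top (H.v_ne_top x) ENNReal.ofReal_ne_top)
      (hstep φ hφ.2.2) (hstep ψ hψ.2.2)
    refine K.eq_of_eq_mul_of_normalized hφ.1 hψ.1 hφ.2.1 hψ.2.1 (c := c) fun x => ?_
    have := hc x
    rw [mul_left_comm] at this
    exact (ENNReal.mul_right_inj (H.v_ne_zero x) (H.v_ne_top x)).1 this

theorem eigenPair {W : Potential X} (hlam : 0 < K.lam0 W) {φ φd : X → ℝ}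
    (hφ : K.IsGroundState W φ) (hφd : K.IsDualGroundState W φd) :
    EigenPair W.invWeight K.PE (ENNReal.ofReal (K.lam0 W)) (fun x => ENNReal.ofReal (φ x))
      (fun x => ENNReal.ofReal (K.μ x) * ENNReal.ofReal (φd x)) where
  Λ_ne_zero := (ENNReal.ofReal_pos.2 hlam).ne'
  Λ_ne_top := ENNReal.ofReal_ne_top
  φ_ne_zero x := (ENNReal.ofReal_pos.2 (hφ.1 x)).ne'
  φ_ne_top _ := ENNReal.ofReal_ne_top
  ν_ne_zero x := mul_ne_zero (ENNReal.ofReal_pos.2 (K.μ_pos x)).ne'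
    (ENNReal.ofReal_pos.2 (hφd.1 x)).ne'
  ν_ne_top _ := ENNReal.mul_ne_top ENNReal.ofReal_ne_top ENNReal.ofReal_ne_top
  right := (K.isGroundState_iff.1 hφ).2.2
  left := K.left_of_swap_eigen (K.isDualGroundState_iff.1 hφd).2.2

end GroundState

end DualKernels

/-! ### Return to real-valued kernels with respect to μ -/

theorem IsExhausting.mem_iff {X : Type*} {A : ℕ → Set X} (hA : IsExhausting A) (n : ℕ) (x : X) :
    x ∈ A n ↔ firstAppearance A x ≤ n := by
  have hmem : x ∈ A (firstAppearance A x) :=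
    Nat.sInf_mem (s := {n | x ∈ A n}) (Set.mem_iUnion.1 (hA.2 ▸ Set.mem_univ x))
  exact ⟨fun h => Nat.sInf_le h, fun h => monotone_nat_of_le_succ hA.1 h hmem⟩

namespace DualKernels

variable {X : Type*} (K : DualKernels X)

theorem toReal_invWeight_mul_tsum (W : Potential X) (x : X) {f : X → ℝ≥0∞} (hf : ∀ y, f y ≠ ∞) :
    (W.invWeight x * ∑' y, f y).toReal = (W.V x)⁻¹ * ∑' y, (f y).toReal := by
  rw [ENNReal.toReal_mul, ENNReal.tsum_toReal_eq hf, Potential.invWeight,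
    ENNReal.toReal_ofReal (inv_nonneg.2 (W.V_pos x).le)]

theorem PE_ne_top (x y : X) : K.PE x y ≠ ∞ := ENNReal.ofReal_ne_top

theorem toReal_PE (x y : X) : (K.PE x y).toReal = K.P x y :=
  ENNReal.toReal_ofReal (K.P_nonneg x y)

/-- The factor μ(y) converts a density with respect to μ into a kernel for counting measure; the
shift n + 1 matches the indexing of `stepKernel`. -/
theorem toReal_stepKernel (W : Potential X)
    (hfin : ∀ n x y, stepKernel W.invWeight K.PE n x y ≠ ∞) (n : ℕ) (x y : X) :
    (stepKernel W.invWeight K.PE n x y).toReal = K.uStep W (n + 1) x y * K.μ y := by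
  induction n generalizing x with
  | zero =>
    have := (K.μ_pos y).ne'
    rw [stepKernel_zero, ENNReal.toReal_mul, toReal_PE, Potential.invWeight,
      ENNReal.toReal_ofReal (inv_nonneg.2 (W.V_pos x).le)]
    simp only [uStep, u, p]
    field_simp
  | succ n ih =>
    rw [stepKernel_succ, stepOp, toReal_invWeight_mul_tsum W x fun z =>
      ENNReal.mul_ne_top (K.PE_ne_top x z) (hfin n z y)]
    simp only [uStep]
    rw [← tsum_mul_left, ← tsum_mul_right]
    refine tsum_congr fun z => ?_
    rw [ENNReal.toReal_mul, ih, toReal_PE]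
    have := (K.μ_pos z).ne'
    simp only [u, p]
    field_simp

theorem toReal_twoStep (W : Potential X) {A : ℕ → Set X} (hA : IsExhausting A) (B : Set X)
    (n : ℕ) (x y : X) :
    (W.invWeight x * ∑' z, {z | z ∉ B ∧ firstAppearance A z ≤ firstAppearance A x ∧
        firstAppearance A z ≤ firstAppearance A y}.indicator
          (fun z => K.PE x z * K.PE z y * W.invWeight z ^ n) z).toReal
      = K.F W A B (n + 1) x y * K.μ y := by
  have hset : {z | z ∉ B ∧ firstAppearance A z ≤ firstAppearance A x ∧
      firstAppearance A z ≤ firstAppearance A y}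
      = Bᶜ ∩ A (firstAppearance A x) ∩ A (firstAppearance A y) := by
    ext z
    simp only [Set.mem_ofPred_eq, Set.mem_inter_iff, Set.mem_compl_iff, hA.mem_iff, and_assoc]
  have hne : ∀ z, K.PE x z * K.PE z y * W.invWeight z ^ n ≠ ∞ := fun z =>
    ENNReal.mul_ne_top (ENNReal.mul_ne_top (K.PE_ne_top x z) (K.PE_ne_top z y))
      (ENNReal.pow_ne_top ENNReal.ofReal_ne_top)
  rw [hset, ← tsum_subtype, ENNReal.toReal_mul, ENNReal.tsum_toReal_eq
    fun z : ↥(Bᶜ ∩ A (firstAppearance A x) ∩ A (firstAppearance A y)) => hne z, F, mul_assoc, ← tsum_mul_right, Potential.invWeight,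
    ENNReal.toReal_ofReal (inv_nonneg.2 (W.V_pos x).le)]
  congr 1
  refine tsum_congr fun z => ?_
  have h1 := (K.μ_pos z).ne'
  have h2 := (K.μ_pos y).ne'
  have h3 := (W.V_pos z).ne'
  rw [ENNReal.toReal_mul, ENNReal.toReal_mul, ENNReal.toReal_pow, toReal_PE, toReal_PE,
    Potential.invWeight, ENNReal.toReal_ofReal (inv_nonneg.2 (W.V_pos z).le), p, p,
    Nat.add_sub_cancel, inv_pow]
  field_simp

theorem F_nonneg (W : Potential X) (A : ℕ → Set X) (B : Set X) (n : ℕ) (x y : X) :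
    0 ≤ K.F W A B n x y := by
  have hp : ∀ x y, 0 ≤ K.p x y := fun x y => div_nonneg (K.P_nonneg x y) (K.μ_pos y).le
  have hV := fun z => (W.V_pos z).le
  exact mul_nonneg (inv_nonneg.2 (hV x)) (tsum_nonneg fun z => mul_nonneg (mul_nonneg
    (mul_nonneg (hp _ _) (hp _ _)) (div_nonneg zero_le_one (pow_nonneg (hV _) _))) (K.μ_pos _).le)

theorem Cminus_le (x : X) : K.Cminus ≤ K.P x x :=
  ciInf_le ⟨0, by rintro _ ⟨x, rfl⟩; exact K.P_nonneg x x⟩ x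

/-- The real form of the kernel estimates. -/
theorem exists_kernel_bounds [Countable X] [Nonempty X] {W : Potential X} {Cs : ℝ}
    (hA1 : K.DirectStep Cs) (hA2 : 0 < K.Cminus) (hW : W.Confining) {φ φd : X → ℝ}
    (hφ : K.IsGroundState W φ) (hφd : K.IsDualGroundState W φd) {A : ℕ → Set X}
    (hA : IsExhausting A) (hV : W.IncreasingAlong A) {B : Set X} (hB : B.Finite) :
    ∃ a b c : ℝ, 0 ≤ a ∧ 0 ≤ b ∧ 0 ≤ c ∧ ∀ n x y,
      (K.lam0 W ^ (n + 1) * φ x * φd y ≤ a * K.uStep W (n + 1) x y) ∧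
      ((x ∈ B ∨ y ∈ B) → K.uStep W (n + 1) x y ≤ b * (K.lam0 W ^ (n + 1) * φ x * φd y)) ∧
      (min Cs⁻¹ K.Cminus ^ (n + 1) * K.F W A B (n + 1) x y ≤ K.uStep W (n + 1) x y) ∧
      (x ∉ B → y ∉ B → K.uStep W (n + 1) x y ≤ c * (K.lam0 W ^ (n + 1) * φ x * φd y
        + max (3 * Cs) K.Cminus⁻¹ ^ (n + 1) * K.F W A B (n + 1) x y)) := by
  have hlam := (K.exists_pos_eigen_lam0 hA1 hW (Classical.arbitrary X)).1
  have H := K.confinedKernel hA1 hW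
  have E := K.eigenPair hlam hφ hφd
  have hCs : 0 < Cs := zero_lt_one.trans_le hA1.2.1
  have hl0 : 0 < min Cs⁻¹ K.Cminus := lt_min (inv_pos.2 hCs) hA2
  have hu0 : 1 ≤ max (3 * Cs) K.Cminus⁻¹ := le_max_of_le_left (by linarith [hA1.2.1])
  have hCm : ∀ x, ENNReal.ofReal K.Cminus ≤ K.PE x x := fun x =>
    ENNReal.ofReal_le_ofReal (K.Cminus_le x)
  have hα : ∀ x y, firstAppearance A x < firstAppearance A y → W.invWeight y ≤ W.invWeight x :=
    fun x y h => ENNReal.ofReal_le_ofReal (inv_anti₀ (W.V_pos x) (hV x y h))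
  obtain ⟨a, ha, hlow⟩ := H.exists_lower E
  obtain ⟨b, hb, hup⟩ := ConfinedKernel.exists_upper_of_mem E hB.toFinset
  obtain ⟨c, hc, hup'⟩ := H.exists_upper E hB.toFinset hα hCm (ENNReal.ofReal_pos.2 hA2).ne'
    ENNReal.ofReal_ne_top (Cup := ENNReal.ofReal (max (3 * Cs) K.Cminus⁻¹))
    -- The argument needs only 2Cs per step, which 3Cs covers.
    (ENNReal.one_le_ofReal.2 hu0) (by
      rw [← ENNReal.ofReal_ofNat, ← ENNReal.ofReal_mul (by norm_num)]
      exact ENNReal.ofReal_le_ofReal (le_max_of_le_left (by linarith)))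
  have hlow' := H.two_step_le_stepKernel (Cl := ENNReal.ofReal (min Cs⁻¹ K.Cminus))
    (ENNReal.ofReal_le_one.2 (min_le_of_left_le (inv_le_one_of_one_le₀ hA1.2.1)))
    (by
      rw [← ENNReal.ofReal_mul hl0.le, ENNReal.ofReal_le_one]
      calc _ ≤ Cs⁻¹ * Cs := mul_le_mul_of_nonneg_right (min_le_left _ _) hCs.le
        _ = 1 := inv_mul_cancel₀ hCs.ne')
    (fun x => (ENNReal.ofReal_le_ofReal (min_le_right _ _)).trans (hCm x))
  rw [hB.coe_toFinset] at hup'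
  -- Finiteness follows from t_{n+1}(x,y)φ(y) ≤ Λ^{n+1}φ(x) with φ(y) > 0.
  have hfin : ∀ n x y, stepKernel W.invWeight K.PE n x y ≠ ∞ := fun n x y h => by
    have := ConfinedKernel.stepKernel_mul_right_le E n x y
    rw [h, ENNReal.top_mul (E.φ_ne_zero y), top_le_iff] at this
    exact ENNReal.mul_ne_top (ENNReal.pow_ne_top E.Λ_ne_top) (E.φ_ne_top x) this
  refine ⟨a.toReal, b.toReal, c.toReal, ENNReal.toReal_nonneg, ENNReal.toReal_nonneg,
    ENNReal.toReal_nonneg, fun n x y => ?_⟩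
  have hμ := K.μ_pos y
  set G := ENNReal.ofReal (K.lam0 W) ^ (n + 1) * ENNReal.ofReal (φ x)
    * (ENNReal.ofReal (K.μ y) * ENNReal.ofReal (φd y)) with hG
  have hGt : G ≠ ∞ := ENNReal.mul_ne_top (ENNReal.mul_ne_top (ENNReal.pow_ne_top E.Λ_ne_top)
    ENNReal.ofReal_ne_top) (E.ν_ne_top y)
  have hGr : G.toReal = K.lam0 W ^ (n + 1) * φ x * φd y * K.μ y := by
    rw [hG, ENNReal.toReal_mul, ENNReal.toReal_mul, ENNReal.toReal_mul, ENNReal.toReal_pow,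
      ENNReal.toReal_ofReal hlam.le, ENNReal.toReal_ofReal (hφ.1 x).le,
      ENNReal.toReal_ofReal hμ.le, ENNReal.toReal_ofReal (hφd.1 y).le]
    ring
  set T := W.invWeight x * ∑' z, {z | z ∉ B ∧ firstAppearance A z ≤ firstAppearance A x ∧
        firstAppearance A z ≤ firstAppearance A y}.indicator
          (fun z => K.PE x z * K.PE z y * W.invWeight z ^ n) z with hT
  have hTr : T.toReal = K.F W A B (n + 1) x y * K.μ y := K.toReal_twoStep W hA B n x y
  have hTlow := hlow' {z | z ∉ B ∧ firstAppearance A z ≤ firstAppearance A x ∧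
        firstAppearance A z ≤ firstAppearance A y} n x y
  rw [← hT] at hTlow
  have hTt : T ≠ ∞ := fun h => by
    rw [h, ENNReal.mul_top (pow_ne_zero _ (ENNReal.ofReal_pos.2 hl0).ne'), top_le_iff] at hTlow
    exact hfin n x y hTlow
  have hsr := K.toReal_stepKernel W hfin n x y
  refine ⟨?_, fun hxy => ?_, ?_, fun hx hy => ?_⟩ <;> refine le_of_mul_le_mul_right ?_ hμ
  · have := ENNReal.toReal_mono (ENNReal.mul_ne_top ha (hfin n x y)) (hlow n x y)
    rw [hGr, ENNReal.toReal_mul, hsr] at this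
    linarith
  · have := ENNReal.toReal_mono (ENNReal.mul_ne_top hb hGt) (hup n x y (by simpa using hxy))
    rw [ENNReal.toReal_mul, hGr, hsr] at this
    linarith
  · have := ENNReal.toReal_mono (hfin n x y) hTlow
    rw [ENNReal.toReal_mul, hTr, hsr, ENNReal.toReal_pow, ENNReal.toReal_ofReal hl0.le] at this
    linarith
  · have hUt : ENNReal.ofReal (max (3 * Cs) K.Cminus⁻¹) ^ (n + 1) * T ≠ ∞ :=
      ENNReal.mul_ne_top (ENNReal.pow_ne_top ENNReal.ofReal_ne_top) hTt
    have := ENNReal.toReal_mono (ENNReal.mul_ne_top hc (ENNReal.add_ne_top.2 ⟨hGt, hUt⟩))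
      (hup' n x (by simpa using hx) y (by simpa using hy))
    rw [ENNReal.toReal_mul, ENNReal.toReal_add hGt hUt, hGr, ENNReal.toReal_mul, hTr, hsr,
      ENNReal.toReal_pow, ENNReal.toReal_ofReal (zero_le_one.trans hu0)] at this
    linarith

end DualKernels

end FeynmanKac

end

/-! ### The main theorem -/

theorem mainTheorem1 {X : Type*} [Countable X] [Infinite X]
    (K : FeynmanKac.DualKernels X) (W : FeynmanKac.Potential X)
    (Cs : ℝ) (hA1 : K.DirectStep Cs) (hA2 : 0 < K.Cminus) (hA3 : K.BoundedDensity)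
    (hB : W.Confining) :
    (∃! φ : X → ℝ, K.IsGroundState W φ) ∧ (∃! φd : X → ℝ, K.IsDualGroundState W φd) ∧
    ∀ φ φd : X → ℝ, K.IsGroundState W φ → K.IsDualGroundState W φd →
    ∀ A : ℕ → Set X, FeynmanKac.IsExhausting A → W.IncreasingAlong A →
    ∀ B : Set X, B.Finite →
    ∃ Ct : ℝ, 0 < Ct ∧
      (∀ n : ℕ, 1 ≤ n → ∀ x y : X, (x ∈ B ∨ y ∈ B) →
        Ct⁻¹ * (K.lam0 W ^ n * φ x * φd y) ≤ K.uStep W n x y ∧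
        K.uStep W n x y ≤ Ct * (K.lam0 W ^ n * φ x * φd y)) ∧
      (∀ n : ℕ, 1 ≤ n → ∀ x y : X, x ∉ B → y ∉ B →
        Ct⁻¹ * (K.lam0 W ^ n * φ x * φd y
            + min Cs⁻¹ K.Cminus ^ n * K.F W A B n x y) ≤ K.uStep W n x y ∧
        K.uStep W n x y ≤ Ct * (K.lam0 W ^ n * φ x * φd y
            + max (3 * Cs) K.Cminus⁻¹ ^ n * K.F W A B n x y)) ∧
      (∀ n : ℕ, 1 ≤ n → ∀ x y : X,
        Ct⁻¹ * (K.lam0 W ^ n * φ x * φd y) ≤ K.uStep W n x y) := by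
  refine ⟨K.existsUnique_groundState hA1 hB, K.existsUnique_dualGroundState hA1 hB, ?_⟩
  intro φ φd hφ hφd A hA hV B hBf
  obtain ⟨a, b, c, ha, hb, hc, h⟩ := K.exists_kernel_bounds hA1 hA2 hB hφ hφd hA hV hBf
  -- One constant serves all bounds; the summand 1 ensures positivity and pays for the F_n term,
  -- which is added to the ground state term in the lower bound.
  have hCt : 0 < a + b + c + 1 := by positivity
  have hG : ∀ n x y, 0 ≤ K.lam0 W ^ n * φ x * φd y := fun n x y =>
    mul_nonneg (mul_nonneg (pow_nonneg (K.lam0_nonneg W) n) (hφ.1 x).le) (hφd.1 y).le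
  have hU : ∀ n x y, 0 ≤ max (3 * Cs) K.Cminus⁻¹ ^ n * K.F W A B n x y := fun n x y =>
    mul_nonneg (pow_nonneg (le_max_of_le_right (inv_nonneg.2 hA2.le)) n) (K.F_nonneg W A B n x y)
  have hL : ∀ n x y, 0 ≤ min Cs⁻¹ K.Cminus ^ n * K.F W A B n x y := fun n x y =>
    mul_nonneg (pow_nonneg (le_min (inv_nonneg.2 (zero_le_one.trans hA1.2.1)) hA2.le) n)
      (K.F_nonneg W A B n x y)
  have hu : ∀ n x y, 0 ≤ K.uStep W (n + 1) x y := fun n x y =>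
    (hL (n + 1) x y).trans (h n x y).2.2.1
  have hlow : ∀ n : ℕ, 1 ≤ n → ∀ x y : X,
      (a + b + c + 1)⁻¹ * (K.lam0 W ^ n * φ x * φd y) ≤ K.uStep W n x y := by
    intro n hn x y
    obtain ⟨m, rfl⟩ := Nat.exists_eq_add_of_le' hn
    rw [inv_mul_le_iff₀ hCt]
    exact (h m x y).1.trans (mul_le_mul_of_nonneg_right (by linarith) (hu m x y))
  refine ⟨a + b + c + 1, hCt, fun n hn x y hxy => ⟨hlow n hn x y, ?_⟩,
    fun n hn x y hx hy => ?_, hlow⟩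
  · obtain ⟨m, rfl⟩ := Nat.exists_eq_add_of_le' hn
    exact ((h m x y).2.1 hxy).trans (mul_le_mul_of_nonneg_right (by linarith) (hG _ x y))
  · obtain ⟨m, rfl⟩ := Nat.exists_eq_add_of_le' hn
    refine ⟨?_, ((h m x y).2.2.2 hx hy).trans
      (mul_le_mul_of_nonneg_right (by linarith) (add_nonneg (hG _ x y) (hU _ x y)))⟩
    rw [inv_mul_le_iff₀ hCt]
    calc _ ≤ a * K.uStep W (m + 1) x y + K.uStep W (m + 1) x y :=
          add_le_add (h m x y).1 (h m x y).2.2.1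
      _ = (a + 1) * K.uStep W (m + 1) x y := by ring
      _ ≤ _ := mul_le_mul_of_nonneg_right (by linarith) (hu m x y)
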